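/- **Theorem (entanglement-width criterion).** A pure $N$-qubit state $|\psi\rangle$ is a unit vector in $(\mathbb C^2)^{\otimes N}$. For a bipartition $(A,B)$ of the qubits let $\rho_A=\mathrm{Tr}_B|\psi\rangle\langle\psi|$, $E_{A,B}(|\psi\rangle)=-\mathrm{Tr}(\rho_A\log_2\rho_A)$ and $\chi_{A,B}(|\psi\rangle)=\mathrm{rank}(\rho_A)$. A subcubic tree is a finite tree all of whose vertices have degree $1$ or $3$; we consider such trees $T$ with exactly $N$ leaves, identified with the qubits. Deleting an edge $e$ of $T$ leaves two components, which induce a bipartition $(A_T^e,B_T^e)$ of the qubits. Define the entropic entanglement width and the Schmidt-rank width by $$E_{\mathrm{wd}}(|\psi\rangle)=\min_T\max_{e\in T}E_{A_T^e,B_T^e}(|\psi\rangle),\qquad \chi_{\mathrm{wd}}(|\psi\rangle)=\min_T\max_{e\in T}\log_2\chi_{A_T^e,B_T^e}(|\psi\rangle),$$ (both are $0$ if $N\le 1$), and for a family $\Psi$ of multi-qubit states put $E_{\mathrm{wd}}(\Psi)=\sup_{|\psi\rangle\in\Psi}E_{\mathrm{wd}}(|\psi\rangle)$ and $\chi_{\mathrm{wd}}(\Psi)=\sup_{|\psi\rangle\in\Psi}\chi_{\mathrm{wd}}(|\psi\rangle)$.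 A family $\Psi$ is a *universal resource* if for every $n$ and every $n$-qubit state $|\phi\rangle$ there are a member $|\psi\rangle\in\Psi$, on $N\ge n$ qubits, and a set $A$ of $n$ of its qubits such that $|\psi\rangle\to|\phi\rangle^{A}|0\rangle^{\bar A}$ is possible with unit probability by a (finite) protocol of local operations on the single qubits, possibly with local ancillas, and classical communication. The *graph state* of a graph $G$ on the qubits is the common eigenvector with eigenvalue $1$ (unique up to a phase) of the operators $\sigma_x^{(a)}\bigotimes_{b\in N(a)}\sigma_z^{(b)}$, one for each vertex $a$. The *rank width* of $G$ is $\min_T\max_{e\in T}$ of the rank over $\mathbb F_2$ of the $A_T^e\times B_T^e$ block of the adjacency matrix of $G$ ($0$ if $G$ has at most one vertex). 1. If $\Psi$ is a universal resource, then $E_{\mathrm{wd}}(\Psi)=\chi_{\mathrm{wd}}(\Psi)=\infty$. 2. Hence a family $\Psi$ on which $E_{\mathrm{wd}}$ is bounded, or on which $\chi_{\mathrm{wd}}$ is bounded, is not a universal resource. 3. In particular, on each of the following families both $E_{\mathrm{wd}}$ and $\chi_{\mathrm{wd}}$ are bounded, and the family is not a universal resource: any family of linear cluster states (graph states of paths);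 any family of GHZ states $(|0\rangle^{\otimes N}+|1\rangle^{\otimes N})/\sqrt2$, $N\ge1$; any family of graph states of graphs whose rank widths are bounded by a common constant. -/

import Mathlib

open scoped BigOperators Matrix

noncomputable section

/-! ## Pure multi-qubit states -/

/-- A pure `n`-qubit state: a normalised vector of amplitudes in the computational basis. -/
structure QubitState (n : ℕ) where
  amp : (Fin n → Fin 2) → ℂ
  normalized : ∑ x, ‖amp x‖ ^ 2 = 1

/-- A pure state of some finite number of qubits. -/
structure MultiQubitState where
  numQubits : ℕ
  state : QubitState numQubits

/-- The operator `⨂ i, P i` on `⨂ i, ℂ^L`, as a matrix in the product basis. -/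
def tensorOp {ι L : Type} [Fintype ι] (P : ι → Matrix L L ℂ) : Matrix (ι → L) (ι → L) ℂ :=
  Matrix.of fun x y => ∏ i, P i (x i) (y i)

/-- The operator `K` acting on party `a`, and the identity acting on all other parties. -/
def localOp {ι L : Type} [Fintype ι] [DecidableEq ι] [DecidableEq L] (a : ι)
    (K : Matrix L L ℂ) : Matrix (ι → L) (ι → L) ℂ :=
  tensorOp (Function.update (fun _ => 1) a K)

/-! ## Local operations and classical communication -/

/-- A finite LOCC protocol for parties `ι`, each holding a local system `ℂ^L`. Either the protocol
halts, or some party `a` performs a quantum operation on its own system, given by finitely many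
Kraus operators `K j` with `∑ j, (K j)ᴴ * K j = 1`, and announces the outcome `j`; the remaining
protocol may depend on `j`, hence on the whole history of outcomes. -/
inductive LOCCProtocol (ι L : Type) [Fintype L] [DecidableEq L] : Type
  | halt : LOCCProtocol ι L
  | round (a : ι) (m : ℕ) (K : Fin m → Matrix L L ℂ) (complete : ∑ j, (K j)ᴴ * K j = 1)
      (next : Fin m → LOCCProtocol ι L) : LOCCProtocol ι L

/-- `p.AllBranches Q v`: when `p` is run on the vector `v`, the final unnormalised vector of every
branch satisfies `Q`. The squared norm of that vector is the probability of the branch. -/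
def LOCCProtocol.AllBranches {ι L : Type} [Fintype ι] [DecidableEq ι] [Fintype L] [DecidableEq L]
    (Q : ((ι → L) → ℂ) → Prop) : LOCCProtocol ι L → ((ι → L) → ℂ) → Prop
  | .halt, v => Q v
  | .round a _ K _ next, v => ∀ j, (next j).AllBranches Q (localOp a (K j) *ᵥ v)

/-- The vector `ψ ⊗ χ` when party `i` holds its qubit (with joint state `ψ`) together with a local
ancilla of dimension `k` (with joint state `χ`). -/
def withAncillas {ι : Type} {k : ℕ} (ψ : (ι → Fin 2) → ℂ) (χ : (ι → Fin k) → ℂ) :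
    (ι → Fin 2 × Fin k) → ℂ :=
  fun x => ψ (fun i => (x i).1) * χ (fun i => (x i).2)

/-- `ψ` can be transformed into `φ` by LOCC with unit probability. Every party may use a local
ancilla of arbitrary finite dimension `k + 1`, initially in the state `0`. In every branch the
qubits must end up in the state `φ`, uncorrelated with the ancillas, which are discarded (a branch
of probability zero has `χ = 0`). -/
def LOCCConvertible {N : ℕ} (ψ φ : (Fin N → Fin 2) → ℂ) : Prop :=
  ∃ (k : ℕ) (p : LOCCProtocol (Fin N) (Fin 2 × Fin (k + 1))),
    p.AllBranches (fun v => ∃ χ : (Fin N → Fin (k + 1)) → ℂ, v = withAncillas φ χ)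
      (withAncillas ψ (Pi.single (fun _ => 0) 1))

/-- The `N`-qubit vector with `φ` on the qubits `A = range f` and `0` on all other qubits. -/
def placeOn {n N : ℕ} (f : Fin n ↪ Fin N) (φ : (Fin n → Fin 2) → ℂ) : (Fin N → Fin 2) → ℂ :=
  open Classical in
  fun x => if ∀ i, i ∉ Set.range f → x i = 0 then φ (fun j => x (f j)) else 0

/-- `ψ ≥_LOCC φ`: for some set of output qubits, `ψ` can be transformed by LOCC with unit
probability into `φ` on these qubits and `0` on all others. -/
def LOCCGe {N n : ℕ} (ψ : QubitState N) (φ : QubitState n) : Prop :=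
  ∃ f : Fin n ↪ Fin N, LOCCConvertible ψ.amp (placeOn f φ.amp)

/-- A family of states is a universal resource if every state of any number of qubits can be
obtained from some member by LOCC. -/
def IsUniversalResource (Ψ : Set MultiQubitState) : Prop :=
  ∀ (n : ℕ) (φ : QubitState n), ∃ s ∈ Ψ, LOCCGe s.state φ

/-! ## Bipartite entanglement -/

/-- The amplitudes of `ψ` as a matrix with respect to the bipartition `(A, complement of A)`. -/
def coeffMatrix {ι L : Type} [DecidableEq ι] (ψ : (ι → L) → ℂ) (A : Finset ι) :
    Matrix ({i // i ∈ A} → L) ({i // i ∉ A} → L) ℂ :=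
  Matrix.of fun x z => ψ ((Equiv.piEquivPiSubtypeProd (fun i => i ∈ A) (fun _ => L)).symm (x, z))

/-- The reduced density matrix `ρ_A`, the partial trace of `|ψ⟩⟨ψ|` over the complement of `A`:
`ρ_A x y = ∑ z, ψ (x, z) * conj (ψ (y, z))`. -/
def reducedDensity {ι L : Type} [Fintype ι] [DecidableEq ι] [Fintype L] (ψ : (ι → L) → ℂ)
    (A : Finset ι) : Matrix ({i // i ∈ A} → L) ({i // i ∈ A} → L) ℂ :=
  coeffMatrix ψ A * (coeffMatrix ψ A)ᴴ

theorem reducedDensity_isHermitian {ι L : Type} [Fintype ι] [DecidableEq ι] [Fintype L]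
    (ψ : (ι → L) → ℂ) (A : Finset ι) : (reducedDensity ψ A).IsHermitian :=
  Matrix.isHermitian_mul_conjTranspose_self _

/-- The entanglement entropy `-Tr (ρ_A log₂ ρ_A)`, through the eigenvalues of `ρ_A`. -/
def entanglementEntropy {ι L : Type} [Fintype ι] [DecidableEq ι] [Fintype L] [DecidableEq L]
    (ψ : (ι → L) → ℂ) (A : Finset ι) : ℝ :=
  -∑ x, (reducedDensity_isHermitian ψ A).eigenvalues x *
    Real.logb 2 ((reducedDensity_isHermitian ψ A).eigenvalues x)

/-- The Schmidt rank `rank ρ_A`. -/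
def schmidtRank {ι L : Type} [Fintype ι] [DecidableEq ι] [Fintype L]
    (ψ : (ι → L) → ℂ) (A : Finset ι) : ℕ :=
  (reducedDensity ψ A).rank

/-! ## Subcubic trees and widths -/

/-- A finite tree all of whose vertices have degree 1 or 3, with its leaves identified with `ι`. -/
structure SubcubicTree (ι : Type) where
  numVertices : ℕ
  graph : SimpleGraph (Fin numVertices)
  isTree : graph.IsTree
  degree_eq : ∀ v, (graph.neighborSet v).ncard = 1 ∨ (graph.neighborSet v).ncard = 3
  leaf : ι ≃ {v // (graph.neighborSet v).ncard = 1}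

/-- For an edge `e`, oriented as `d`: the labels of the leaves that lie in the component of
`T \ e` containing the first vertex of `d`. -/
def SubcubicTree.side {ι : Type} [Fintype ι] (T : SubcubicTree ι) (d : T.graph.Dart) : Finset ι :=
  open Classical in
  Finset.univ.filter fun i =>
    (T.graph.deleteEdges {d.edge}).Reachable d.fst (T.leaf i : Fin T.numVertices)

/-- The minimum over subcubic trees with leaves `ι` of the maximum of `f` over the sides of the
edges. Every edge counts with both its orientations; the functions `f` used below are symmetric
under complements. Without such a tree (fewer than two leaves) the value is `0` in `ℝ` and `ℕ`. -/
def treeMinMax {ι : Type} [Fintype ι] {α : Type} [ConditionallyCompleteLattice α]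
    (f : Finset ι → α) : α :=
  ⨅ T : SubcubicTree ι, ⨆ d : T.graph.Dart, f (T.side d)

/-- The entropic entanglement width. -/
def entropicWidth {n : ℕ} (ψ : QubitState n) : ℝ :=
  treeMinMax fun A => entanglementEntropy ψ.amp A

/-- The Schmidt-rank width. -/
def schmidtRankWidth {n : ℕ} (ψ : QubitState n) : ℝ :=
  treeMinMax fun A => Real.logb 2 (schmidtRank ψ.amp A)

/-- The supremum of a functional over a family of states, `⊤` if unbounded. -/
def supOver (E : ∀ {n : ℕ}, QubitState n → ℝ) (Ψ : Set MultiQubitState) : EReal :=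
  ⨆ s ∈ Ψ, ((E s.state : ℝ) : EReal)

/-- The functional is bounded from above by a constant on the family. -/
def IsBoundedOn (E : ∀ {n : ℕ}, QubitState n → ℝ) (Ψ : Set MultiQubitState) : Prop :=
  ∃ C : ℝ, ∀ s ∈ Ψ, E s.state ≤ C

/-! ## Graph states, rank width, GHZ states -/

def pauliX : Matrix (Fin 2) (Fin 2) ℂ := !![0, 1; 1, 0]

def pauliZ : Matrix (Fin 2) (Fin 2) ℂ := !![1, 0; 0, -1]

/-- The correlation operator: `σ_x` on `a` and `σ_z` on every neighbour of `a`. -/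
def correlationOp {n : ℕ} (G : SimpleGraph (Fin n)) (a : Fin n) :
    Matrix (Fin n → Fin 2) (Fin n → Fin 2) ℂ :=
  open Classical in
  tensorOp fun b => if b = a then pauliX else if G.Adj a b then pauliZ else 1

/-- `ψ` is the graph state of `G` (unique up to a phase): the common eigenvector, with eigenvalue
`1`, of all the correlation operators. -/
def IsGraphState {n : ℕ} (G : SimpleGraph (Fin n)) (ψ : QubitState n) : Prop :=
  ∀ a, correlationOp G a *ᵥ ψ.amp = ψ.amp

/-- The rank over the two-element field of the adjacency matrix between `A` and its complement. -/
def cutRank {n : ℕ} (G : SimpleGraph (Fin n)) (A : Finset (Fin n)) : ℕ :=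
  open Classical in
  (Matrix.of fun (i : {i // i ∈ A}) (j : {j // j ∉ A}) =>
    if G.Adj i j then (1 : ZMod 2) else 0).rank

/-- The rank width of a graph. -/
def rankWidth {n : ℕ} (G : SimpleGraph (Fin n)) : ℕ :=
  treeMinMax fun A => cutRank G A

/-- A linear cluster state: the graph state of a path. -/
def IsLinearCluster {n : ℕ} (ψ : QubitState n) : Prop :=
  IsGraphState (SimpleGraph.pathGraph n) ψ

/-- The GHZ state `(|0…0⟩ + |1…1⟩) / √2` of `n ≥ 1` qubits. -/
def IsGHZ {n : ℕ} (ψ : QubitState n) : Prop :=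
  1 ≤ n ∧ ψ.amp = (((Real.sqrt 2)⁻¹ : ℝ) : ℂ) • (Pi.single (fun _ => 0) 1 + Pi.single (fun _ => 1) 1)

end

/-! Both widths are LOCC monotones, and some states have arbitrarily large width; hence a universal
resource has members of arbitrarily large width.

On a fixed cut, write a state as its coefficient matrix. A local operation multiplies this matrix on
one side by Kraus operators, and the reduced density of the other side, summed over the outcomes,
does not change. Concavity of the von Neumann entropy (`sum_homEntropy_le`) then shows that the
average entropy does not grow; the entropy is extended homogeneously to unnormalised states, so that
branch probabilities are absorbed. The rank does not grow in any single branch. This yields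
`LOCCConvertible.cutEntropy_le` and `LOCCConvertible.rank_le`.

The target state lives on a subset of the qubits, so a tree for the resource has to be restricted to
those leaves. Trees are therefore traded for hierarchical decompositions of all leaves but one
(`BranchDecomp`), where restriction is a simple recursion; `SubcubicTree.branchDecomp` and
`BranchDecomp.exists_subcubicTree` translate in the two directions.

Every decomposition of a large set has a balanced cluster (`BranchDecomp.exists_balanced`), so a
state with large entropy on all balanced cuts has large width. Such a state is the uniform
superposition of the strings with Hamming weight divisible by `r`: by a character sum, weights
modulo `r` are nearly equidistributed on each side, the rows of the reduced density have absolute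
sum at most `8 / r`, and the entropy is at least `log₂ (r / 8)`. The Schmidt-rank width dominates
the entropic one, so these states serve for both.

For the examples it suffices to bound the Schmidt-rank width: a graph state has Schmidt rank at most
`2 ^ cutRank`, a path has a caterpillar tree with all cut ranks at most one, and a GHZ state has
Schmidt rank at most two. -/

/-! ### Spectral entropy of matrices: concavity, tensor products, upper and lower bounds. -/

section SpectralEntropy

open Real Matrix
open scoped ComplexOrder

/-- The sum of `-λ log λ` over the roots `λ` of the characteristic polynomial. -/
noncomputable def specEntropy {n : Type*} [Fintype n] [DecidableEq n] (M : Matrix n n ℂ) : ℝ :=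
  (M.charpoly.roots.map fun z => negMulLog z.re).sum

variable {m n : Type*} [Fintype m] [DecidableEq m] [Fintype n] [DecidableEq n]

theorem specEntropy_of_isHermitian {M : Matrix n n ℂ} (hM : M.IsHermitian) :
    specEntropy M = ∑ i, negMulLog (hM.eigenvalues i) := by
  rw [specEntropy, hM.roots_charpoly_eq_eigenvalues, Multiset.map_map]
  exact congrArg Multiset.sum (Multiset.map_congr rfl fun i _ => by simp)

theorem specEntropy_reindex (e : m ≃ n) (M : Matrix m m ℂ) :
    specEntropy (Matrix.reindex e e M) = specEntropy M := by
  rw [specEntropy, Matrix.charpoly_reindex, specEntropy]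

/-- The two characteristic polynomials agree up to powers of `X`, and the extra zero roots
contribute `negMulLog 0 = 0`. This equates the entropies of the two sides of a cut, whose dimensions
differ. -/
theorem specEntropy_mul_comm (A : Matrix m n ℂ) (B : Matrix n m ℂ) :
    specEntropy (A * B) = specEntropy (B * A) := by
  have h := congrArg (fun p : Polynomial ℂ => (p.roots.map fun z : ℂ => negMulLog z.re).sum)
    (Matrix.charpoly_mul_comm' A B)
  have key : ∀ (k : ℕ) (p : Polynomial ℂ), p ≠ 0 →
      ((Polynomial.X ^ k * p).roots.map fun z : ℂ => negMulLog z.re).sum =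
        (p.roots.map fun z : ℂ => negMulLog z.re).sum := by
    intro k p hp
    rw [Polynomial.roots_mul (mul_ne_zero (pow_ne_zero _ Polynomial.X_ne_zero) hp)]
    simp [Multiset.map_nsmul, Multiset.sum_nsmul]
  rwa [key _ _ (Matrix.charpoly_monic _).ne_zero, key _ _ (Matrix.charpoly_monic _).ne_zero] at h

theorem specEntropy_conj_diagonal (U : Matrix n n ℂ) (hU : Uᴴ * U = 1) (d : n → ℝ) :
    specEntropy (U * Matrix.diagonal (fun i => (d i : ℂ)) * Uᴴ) = ∑ i, negMulLog (d i) := by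
  rw [specEntropy_mul_comm, ← mul_assoc, hU, one_mul, specEntropy, Matrix.charpoly_diagonal,
    Polynomial.roots_prod]
  · simp only [Polynomial.roots_X_sub_C, Multiset.bind_singleton, Multiset.map_map]
    exact congrArg Multiset.sum (Multiset.map_congr rfl fun i _ => by simp)
  · simp [Finset.prod_ne_zero_iff, Polynomial.X_sub_C_ne_zero]

theorem exists_unitary_diagonalization {M : Matrix n n ℂ} (hM : M.IsHermitian) :
    ∃ U : Matrix n n ℂ, Uᴴ * U = 1 ∧ U * Uᴴ = 1 ∧
      M = U * Matrix.diagonal (fun i => (hM.eigenvalues i : ℂ)) * Uᴴ := by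
  refine ⟨hM.eigenvectorUnitary, ?_, ?_, ?_⟩
  · exact Unitary.coe_star_mul_self hM.eigenvectorUnitary
  · exact Unitary.coe_mul_star_self hM.eigenvectorUnitary
  · have := hM.spectral_theorem
    rw [Unitary.conjStarAlgAut_apply] at this
    exact this

theorem sum_normSq_row_of_mul_conjTranspose {Q : Matrix n n ℂ} (hQ : Q * Qᴴ = 1) (i : n) :
    ∑ k, ‖Q i k‖ ^ 2 = 1 := by
  have h := congrFun (congrFun hQ i) i
  simp only [Matrix.mul_apply, Matrix.conjTranspose_apply, Matrix.one_apply_eq, RCLike.star_def,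
    Complex.mul_conj'] at h
  exact_mod_cast h

theorem sum_normSq_col_of_conjTranspose_mul {Q : Matrix n n ℂ} (hQ : Qᴴ * Q = 1) (k : n) :
    ∑ i, ‖Q i k‖ ^ 2 = 1 := by
  have h := congrFun (congrFun hQ k) k
  simp only [Matrix.mul_apply, Matrix.conjTranspose_apply, Matrix.one_apply_eq, RCLike.star_def,
    Complex.conj_mul'] at h
  exact_mod_cast h

/-- Diagonal entries in an arbitrary orthonormal basis have at least the spectral entropy. -/
theorem specEntropy_le_sum_diag {M : Matrix n n ℂ} (hM : M.PosSemidef) {W : Matrix n n ℂ}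
    (hW : Wᴴ * W = 1) (hW' : W * Wᴴ = 1) :
    specEntropy M ≤ ∑ i, negMulLog ((Wᴴ * M * W) i i).re := by
  obtain ⟨U, hU, hU', hMU⟩ := exists_unitary_diagonalization hM.isHermitian
  set ev := hM.isHermitian.eigenvalues with hev
  have hev0 : ∀ k, 0 ≤ ev k := hM.eigenvalues_nonneg
  set Q := Wᴴ * U with hQ
  have h1 : Q * Qᴴ = 1 := by
    rw [hQ, conjTranspose_mul, conjTranspose_conjTranspose, mul_assoc, ← mul_assoc U, hU',
      one_mul, hW]
  have h2 : Qᴴ * Q = 1 := by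
    rw [hQ, conjTranspose_mul, conjTranspose_conjTranspose, mul_assoc, ← mul_assoc W, hW',
      one_mul, hU]
  -- The `‖Q i k‖ ^ 2` form a doubly stochastic matrix: unit row sums permit Jensen's inequality,
  -- unit column sums recover the spectral entropy.
  have hdiag : ∀ i, ((Wᴴ * M * W) i i).re = ∑ k, ‖Q i k‖ ^ 2 * ev k := by
    intro i
    have : Wᴴ * M * W = Q * Matrix.diagonal (fun i => (ev i : ℂ)) * Qᴴ := by
      rw [hMU, hQ, conjTranspose_mul, conjTranspose_conjTranspose]
      simp only [mul_assoc]
    rw [this, Matrix.mul_apply, Complex.re_sum]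
    refine Finset.sum_congr rfl fun k _ => ?_
    rw [Matrix.mul_diagonal, conjTranspose_apply, RCLike.star_def, mul_right_comm,
      Complex.mul_conj', ← Complex.ofReal_pow, ← Complex.ofReal_mul, Complex.ofReal_re]
  calc specEntropy M = ∑ k, negMulLog (ev k) := specEntropy_of_isHermitian _
    _ = ∑ k, (∑ i, ‖Q i k‖ ^ 2) * negMulLog (ev k) := by
        simp [sum_normSq_col_of_conjTranspose_mul h2]
    _ = ∑ i, ∑ k, ‖Q i k‖ ^ 2 * negMulLog (ev k) := by
        simp_rw [Finset.sum_mul]; exact Finset.sum_comm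
    _ ≤ ∑ i, negMulLog ((Wᴴ * M * W) i i).re := by
        refine Finset.sum_le_sum fun i _ => ?_
        rw [hdiag]
        exact concaveOn_negMulLog.le_map_sum (fun k _ => by positivity)
          (sum_normSq_row_of_mul_conjTranspose h1 i) (fun k _ => hev0 k)

/-- Dividing by the total gives a probability vector, and `negMulLog_mul` isolates the scaling. The
right side is the total times a Shannon entropy, hence homogeneous of degree one. -/
theorem sum_negMulLog_sub {I : Type*} [Fintype I] (x : I → ℝ) (hx : ∀ i, 0 ≤ x i) :
    ∑ i, negMulLog (x i) - negMulLog (∑ i, x i) =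
      (∑ i, x i) * ∑ i, negMulLog (x i / ∑ i, x i) := by
  rcases eq_or_ne (∑ i, x i) 0 with h | h
  · have h0 : ∀ i, x i = 0 := by
      simpa [Finset.sum_eq_zero_iff_of_nonneg (fun i _ => hx i)] using h
    simp [h0]
  · set p := ∑ i, x i with hp
    have h1 : ∀ i, negMulLog (x i) = p * negMulLog (x i / p) + x i / p * negMulLog p := by
      intro i
      conv_lhs => rw [← mul_div_cancel₀ (x i) h]
      rw [negMulLog_mul]; ring
    simp_rw [h1]
    rw [Finset.sum_add_distrib, ← Finset.sum_mul, ← Finset.sum_div, ← hp, div_self h,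
      Finset.mul_sum]
    ring

/-- Superadditivity of the homogeneous Shannon entropy. -/
theorem sum_negMulLog_superadditive {I J : Type*} [Fintype I] [Fintype J] (x : J → I → ℝ)
    (hx : ∀ j i, 0 ≤ x j i) :
    ∑ j, (∑ i, negMulLog (x j i) - negMulLog (∑ i, x j i)) ≤
      ∑ i, negMulLog (∑ j, x j i) - negMulLog (∑ i, ∑ j, x j i) := by
  rw [sum_negMulLog_sub _ (fun i => Finset.sum_nonneg fun j _ => hx j i)]
  simp_rw [fun j => sum_negMulLog_sub (x j) (hx j)]
  set p : J → ℝ := fun j => ∑ i, x j i with hp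
  have hp0 : ∀ j, 0 ≤ p j := fun j => Finset.sum_nonneg fun i _ => hx j i
  have hP : ∑ i, ∑ j, x j i = ∑ j, p j := Finset.sum_comm
  rw [hP]
  change ∑ j, p j * ∑ i, negMulLog (x j i / p j) ≤ _
  rcases eq_or_ne (∑ j, p j) 0 with h | h
  · have h0 : ∀ j, p j = 0 := by
      simpa [Finset.sum_eq_zero_iff_of_nonneg (fun j _ => hp0 j)] using h
    simp [h0]
  · set P := ∑ j, p j with hPdef
    have hPpos : 0 < P := lt_of_le_of_ne (Finset.sum_nonneg fun j _ => hp0 j) (Ne.symm h)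
    -- Jensen's inequality for the mixture of the vectors `x j / p j` with weights `p j / P`. Where
    -- `p j = 0` the vector `x j` vanishes, so the division by zero is harmless.
    have key : ∀ i, ∑ j, p j / P * negMulLog (x j i / p j) ≤ negMulLog ((∑ j, x j i) / P) := by
      intro i
      have := concaveOn_negMulLog.le_map_sum (t := Finset.univ) (w := fun j => p j / P)
        (p := fun j => x j i / p j) (fun j _ => div_nonneg (hp0 j) hPpos.le)
        (by rw [← Finset.sum_div, ← hPdef, div_self h])
        (fun j _ => div_nonneg (hx j i) (hp0 j))
      refine this.trans_eq ?_
      congr 1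
      rw [Finset.sum_div]
      refine Finset.sum_congr rfl fun j _ => ?_
      rcases eq_or_ne (p j) 0 with h0 | h0
      · have : x j i = 0 := by
          have := (Finset.sum_eq_zero_iff_of_nonneg (fun i _ => hx j i)).1 h0 i (Finset.mem_univ _)
          exact this
        simp [this]
      · simp only [smul_eq_mul]; field_simp
    calc ∑ j, p j * ∑ i, negMulLog (x j i / p j)
        = P * ∑ i, ∑ j, p j / P * negMulLog (x j i / p j) := by
          rw [Finset.sum_comm, Finset.mul_sum]
          refine Finset.sum_congr rfl fun j _ => ?_
          rw [← Finset.mul_sum]; field_simp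
      _ ≤ _ := by gcongr with i; exact key i

/-- The von Neumann entropy, extended homogeneously to unnormalised density matrices. -/
noncomputable def homEntropy (M : Matrix n n ℂ) : ℝ := specEntropy M - negMulLog M.trace.re

theorem homEntropy_mul_comm (A : Matrix m n ℂ) (B : Matrix n m ℂ) :
    homEntropy (A * B) = homEntropy (B * A) := by
  rw [homEntropy, homEntropy, specEntropy_mul_comm, Matrix.trace_mul_comm]

theorem homEntropy_reindex (e : m ≃ n) (M : Matrix m m ℂ) :
    homEntropy (Matrix.reindex e e M) = homEntropy M := by
  rw [homEntropy, specEntropy_reindex, homEntropy]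
  congr 3
  simp only [trace, diag, reindex_apply, submatrix_apply]
  exact e.symm.sum_comp (fun i => M i i)

/-- Concavity of the von Neumann entropy, in homogeneous form. -/
theorem sum_homEntropy_le {J : Type*} [Fintype J] (M : J → Matrix n n ℂ)
    (hM : ∀ j, (M j).PosSemidef) : ∑ j, homEntropy (M j) ≤ homEntropy (∑ j, M j) := by
  have hS : (∑ j, M j).PosSemidef := Matrix.posSemidef_sum _ fun j _ => hM j
  -- In an eigenbasis of the sum, passing to diagonals keeps the entropy of the sum and can only
  -- raise that of each `M j`; a classical inequality remains.
  obtain ⟨W, hW, hW', hMW⟩ := exists_unitary_diagonalization hS.isHermitian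
  set x : J → n → ℝ := fun j i => ((Wᴴ * M j * W) i i).re with hxdef
  have hx : ∀ j i, 0 ≤ x j i := by
    intro j i
    have h := ((hM j).conjTranspose_mul_mul_same W).diag_nonneg (i := i)
    exact (Complex.le_def.1 h).1
  have htr : ∀ j, ∑ i, x j i = (M j).trace.re := by
    intro j
    have : (M j).trace = (Wᴴ * M j * W).trace := by
      rw [Matrix.trace_mul_comm, ← mul_assoc, hW', one_mul]
    rw [this, Matrix.trace, Complex.re_sum]; rfl
  have hsum : ∀ i, ∑ j, x j i = hS.isHermitian.eigenvalues i := by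
    intro i
    have h1 : Wᴴ * (∑ j, M j) * W =
        Matrix.diagonal (fun i => (hS.isHermitian.eigenvalues i : ℂ)) := by
      conv_lhs => rw [hMW]
      rw [show ∀ D : Matrix n n ℂ, Wᴴ * (W * D * Wᴴ) * W = (Wᴴ * W) * D * (Wᴴ * W) from
        fun D => by simp only [mul_assoc], hW, one_mul, mul_one]
    have h2 := congrFun (congrFun h1 i) i
    rw [Matrix.mul_sum, Matrix.sum_mul, Matrix.sum_apply, Matrix.diagonal_apply_eq] at h2
    have h3 := congrArg Complex.re h2
    rwa [Complex.re_sum, Complex.ofReal_re] at h3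
  calc ∑ j, homEntropy (M j)
      ≤ ∑ j, (∑ i, negMulLog (x j i) - negMulLog (∑ i, x j i)) := by
        refine Finset.sum_le_sum fun j _ => ?_
        rw [homEntropy, htr]
        exact sub_le_sub_right (specEntropy_le_sum_diag (hM j) hW hW') _
    _ ≤ ∑ i, negMulLog (∑ j, x j i) - negMulLog (∑ i, ∑ j, x j i) :=
        sum_negMulLog_superadditive x hx
    _ = homEntropy (∑ j, M j) := by
        rw [homEntropy, specEntropy_of_isHermitian hS.isHermitian, Finset.sum_comm]
        simp_rw [hsum, htr, Matrix.trace_sum, Complex.re_sum]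

theorem homEntropy_nonneg {M : Matrix n n ℂ} (hM : M.PosSemidef) : 0 ≤ homEntropy M := by
  have hev0 := hM.eigenvalues_nonneg
  have htr : M.trace.re = ∑ i, hM.isHermitian.eigenvalues i := by
    rw [hM.isHermitian.trace_eq_sum_eigenvalues]; simp
  rw [homEntropy, specEntropy_of_isHermitian hM.isHermitian, htr, sum_negMulLog_sub _ hev0]
  have hs := Finset.sum_nonneg fun i (_ : i ∈ Finset.univ) => hev0 i
  refine mul_nonneg hs (Finset.sum_nonneg fun i _ => ?_)
  exact negMulLog_nonneg (div_nonneg (hev0 i) hs) (div_le_one_of_le₀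
    (Finset.single_le_sum (fun i _ => hev0 i) (Finset.mem_univ i)) hs)

open Kronecker in
theorem specEntropy_kronecker {A : Matrix m m ℂ} {B : Matrix n n ℂ} (hA : A.IsHermitian)
    (hB : B.IsHermitian) :
    specEntropy (A ⊗ₖ B) = B.trace.re * specEntropy A + A.trace.re * specEntropy B := by
  obtain ⟨U, hU, hU', hAU⟩ := exists_unitary_diagonalization hA
  obtain ⟨V, hV, hV', hBV⟩ := exists_unitary_diagonalization hB
  have h : A ⊗ₖ B = (U ⊗ₖ V) * Matrix.diagonal (fun i : m × n =>
      ((hA.eigenvalues i.1 * hB.eigenvalues i.2 : ℝ) : ℂ)) * (U ⊗ₖ V)ᴴ := by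
    rw [conjTranspose_kronecker]
    have : Matrix.diagonal (fun i : m × n =>
      ((hA.eigenvalues i.1 * hB.eigenvalues i.2 : ℝ) : ℂ)) =
        Matrix.diagonal (fun i => (hA.eigenvalues i : ℂ)) ⊗ₖ
          Matrix.diagonal (fun i => (hB.eigenvalues i : ℂ)) := by
      rw [diagonal_kronecker_diagonal]; simp
    rw [this, ← mul_kronecker_mul, ← mul_kronecker_mul, ← hAU, ← hBV]
  rw [h, specEntropy_conj_diagonal _ (by
    rw [conjTranspose_kronecker, ← mul_kronecker_mul, hU, hV, one_kronecker_one]),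
    specEntropy_of_isHermitian hA, specEntropy_of_isHermitian hB, hA.trace_eq_sum_eigenvalues,
    hB.trace_eq_sum_eigenvalues, Fintype.sum_prod_type]
  simp only [negMulLog_mul, Finset.sum_add_distrib, ← Finset.mul_sum, ← Finset.sum_mul]
  simp

-- Entropy is additive on tensor products; the traces appear as factors because `homEntropy` is
-- homogeneous of degree one.
open Kronecker in
theorem homEntropy_kronecker {A : Matrix m m ℂ} {B : Matrix n n ℂ} (hA : A.IsHermitian)
    (hB : B.IsHermitian) :
    homEntropy (A ⊗ₖ B) = B.trace.re * homEntropy A + A.trace.re * homEntropy B := by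
  have h : (A ⊗ₖ B).trace.re = A.trace.re * B.trace.re := by
    have hA' : A.trace = (A.trace.re : ℂ) := by rw [hA.trace_eq_sum_eigenvalues]; simp
    rw [trace_kronecker, hA', Complex.re_ofReal_mul]; simp
  rw [homEntropy, specEntropy_kronecker hA hB, h, negMulLog_mul, homEntropy, homEntropy]
  ring

/-- The entropy of a normalised density matrix is at most the logarithm of its rank. -/
theorem specEntropy_le_log_rank {M : Matrix n n ℂ} (hM : M.PosSemidef) (ht : M.trace = 1) :
    specEntropy M ≤ Real.log M.rank := by
  have hev0 := hM.eigenvalues_nonneg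
  set ev := hM.isHermitian.eigenvalues with hev
  have htr : ∑ i, ev i = 1 := by
    have := hM.isHermitian.trace_eq_sum_eigenvalues
    rw [ht] at this; simpa using congrArg Complex.re this.symm
  set s : Finset n := Finset.univ.filter fun i => ev i ≠ 0 with hs
  have hcard : M.rank = s.card := by
    rw [hM.isHermitian.rank_eq_card_non_zero_eigs, Fintype.card_subtype]
  have hsum : ∑ i ∈ s, ev i = 1 := by
    rw [← htr]; exact Finset.sum_filter_ne_zero _
  have hpos : 0 < s.card := by
    rcases Nat.eq_zero_or_pos s.card with h | h
    · rw [Finset.card_eq_zero] at h; rw [h] at hsum; simp at hsum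
    · exact h
  have hc : (0 : ℝ) < s.card := by exact_mod_cast hpos
  have h1 : specEntropy M = ∑ i ∈ s, negMulLog (ev i) := by
    rw [specEntropy_of_isHermitian hM.isHermitian, Finset.sum_filter_of_ne]
    intro i _ h h0; exact h (by rw [h0, negMulLog_zero])
  -- Jensen's inequality with uniform weights on the nonzero eigenvalues, whose number is the rank.
  have h2 := concaveOn_negMulLog.le_map_sum (t := s) (w := fun _ => (s.card : ℝ)⁻¹)
    (p := ev) (fun _ _ => by positivity) (by simp [hc.ne']) (fun i _ => hev0 i)
  simp only [smul_eq_mul, ← Finset.mul_sum, hsum, mul_one] at h2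
  rw [h1, hcard]
  rw [negMulLog, log_inv] at h2
  have h3 := mul_le_mul_of_nonneg_left h2 hc.le
  rw [← mul_assoc, mul_inv_cancel₀ hc.ne', one_mul] at h3
  refine h3.trans_eq ?_
  field_simp

/-- A uniform bound on the absolute row sums bounds the entropy from below. -/
theorem neg_log_le_specEntropy {M : Matrix n n ℂ} (hM : M.PosSemidef) (ht : M.trace = 1)
    {c : ℝ} (hc : ∀ i, ∑ j, ‖M i j‖ ≤ c) : -Real.log c ≤ specEntropy M := by
  have hev0 := hM.eigenvalues_nonneg
  set ev := hM.isHermitian.eigenvalues with hev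
  have htr : ∑ i, ev i = 1 := by
    have := hM.isHermitian.trace_eq_sum_eigenvalues
    rw [ht] at this; simpa using congrArg Complex.re this.symm
  have hle : ∀ i, ev i ≤ c := by
    intro i
    have he : Module.End.HasEigenvalue (Matrix.toLin' M) (ev i : ℂ) := by
      refine Module.End.hasEigenvalue_of_hasEigenvector
        (x := (hM.isHermitian.eigenvectorBasis i : n → ℂ)) ⟨?_, ?_⟩
      · rw [Module.End.mem_eigenspace_iff, Matrix.toLin'_apply,
          hM.isHermitian.mulVec_eigenvectorBasis]
        ext; simp [hev]
      · intro h0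
        have h1 := hM.isHermitian.eigenvectorBasis.orthonormal.1 i
        have h2 : hM.isHermitian.eigenvectorBasis i = 0 := by ext k; exact congrFun h0 k
        rw [h2] at h1; simp at h1
    -- Gershgorin: the eigenvalue lies within the off-diagonal row sum of some diagonal entry, so
    -- the full row sum bounds it.
    obtain ⟨k, hk⟩ := eigenvalue_mem_ball he
    rw [Metric.mem_closedBall, dist_eq_norm] at hk
    calc ev i = ‖(ev i : ℂ)‖ := by rw [Complex.norm_real, norm_of_nonneg (hev0 i)]
      _ ≤ ‖(ev i : ℂ) - M k k‖ + ‖M k k‖ := by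
          simpa using norm_add_le ((ev i : ℂ) - M k k) (M k k)
      _ ≤ ∑ j ∈ Finset.univ.erase k, ‖M k j‖ + ‖M k k‖ := by gcongr
      _ = ∑ j, ‖M k j‖ := Finset.sum_erase_add _ _ (Finset.mem_univ k)
      _ ≤ c := hc k
  rw [specEntropy_of_isHermitian hM.isHermitian]
  calc -Real.log c = ∑ i, ev i * (-Real.log c) := by rw [← Finset.sum_mul, htr, one_mul]
    _ ≤ ∑ i, negMulLog (ev i) := by
      refine Finset.sum_le_sum fun i _ => ?_
      rw [negMulLog, neg_mul, mul_neg, neg_le_neg_iff]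
      rcases (hev0 i).eq_or_lt with h | h
      · simp [← h]
      · exact mul_le_mul_of_nonneg_left (Real.log_le_log h (hle i)) h.le

end SpectralEntropy

/-! ### Local operators and their action on coefficient matrices. -/

section LocalOperators

set_option linter.unusedSectionVars false

open Matrix

variable {ι L : Type} [Fintype ι] [DecidableEq ι] [Fintype L] [DecidableEq L]

/-- The identity factors kill every `y` that differs from `x` away from `a`. The algebra of local
operators is derived from this formula. -/
theorem localOp_mulVec_apply (a : ι) (K : Matrix L L ℂ) (v : (ι → L) → ℂ) (x : ι → L) :
    (localOp a K *ᵥ v) x = ∑ l, K (x a) l * v (Function.update x a l) := by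
  rw [Matrix.mulVec, dotProduct]
  symm
  refine Fintype.sum_of_injective (fun l => Function.update x a l)
    (Function.update_injective x a) _ _ ?_ ?_
  · intro y hy
    have : ∃ i, i ≠ a ∧ x i ≠ y i := by
      by_contra! h
      refine hy ⟨y a, ?_⟩
      ext1 i
      rcases eq_or_ne i a with rfl | hi
      · simp
      · simp [hi, h i hi]
    obtain ⟨i, hi, hxy⟩ := this
    rw [localOp, tensorOp, of_apply, Finset.prod_eq_zero (Finset.mem_univ i), zero_mul]
    rw [Function.update_of_ne hi, one_apply_ne hxy]
  · intro l
    congr 1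
    rw [localOp, tensorOp, of_apply, ← Finset.mul_prod_erase _ _ (Finset.mem_univ a),
      Finset.prod_eq_one]
    · simp
    · intro i hi
      rw [Finset.mem_erase] at hi
      simp [Function.update_of_ne hi.1]

theorem localOp_mul (a : ι) (K K' : Matrix L L ℂ) :
    localOp a K * localOp a K' = localOp a (K * K') := by
  refine Matrix.mulVec_injective (funext fun v => funext fun x => ?_)
  rw [← mulVec_mulVec]
  simp only [localOp_mulVec_apply, Function.update_self, Function.update_idem, mul_apply,
    Finset.mul_sum, Finset.sum_mul, mul_assoc]
  exact Finset.sum_comm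

theorem localOp_one (a : ι) : localOp a (1 : Matrix L L ℂ) = 1 := by
  refine Matrix.mulVec_injective (funext fun v => funext fun x => ?_)
  simp [localOp_mulVec_apply, one_apply]

theorem localOp_sum {J : Type*} [Fintype J] (a : ι) (K : J → Matrix L L ℂ) :
    localOp a (∑ j, K j) = ∑ j, localOp a (K j) := by
  refine Matrix.mulVec_injective (funext fun v => funext fun x => ?_)
  simp only [localOp_mulVec_apply, sum_mulVec, Finset.sum_apply, Matrix.sum_apply, Finset.sum_mul]
  exact Finset.sum_comm

theorem localOp_conjTranspose (a : ι) (K : Matrix L L ℂ) :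
    (localOp a K)ᴴ = localOp a Kᴴ := by
  ext x y
  simp only [localOp, tensorOp, conjTranspose_apply, of_apply, star_prod]
  refine Finset.prod_congr rfl fun i _ => ?_
  rcases eq_or_ne i a with rfl | hi
  · simp
  · simp [hi, one_apply, eq_comm, apply_ite]

theorem sum_localOp_conjTranspose_mul {J : Type*} [Fintype J] (a : ι) {K : J → Matrix L L ℂ}
    (hK : ∑ j, (K j)ᴴ * K j = 1) : ∑ j, (localOp a (K j))ᴴ * localOp a (K j) = 1 := by
  simp_rw [localOp_conjTranspose, localOp_mul, ← localOp_sum, hK, localOp_one]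

/-- Conservation of probability: the weights of the outcomes add up to the weight before the
operation. -/
theorem sum_normSq_mulVec {X J : Type*} [Fintype X] [DecidableEq X] [Fintype J]
    {K : J → Matrix X X ℂ} (hK : ∑ j, (K j)ᴴ * K j = 1) (v : X → ℂ) :
    ∑ j, ∑ x, ‖(K j *ᵥ v) x‖ ^ 2 = ∑ x, ‖v x‖ ^ 2 := by
  have key : ∀ w : X → ℂ, ((∑ x, ‖w x‖ ^ 2 : ℝ) : ℂ) = star w ⬝ᵥ w := by
    intro w
    simp [dotProduct, Complex.conj_mul']
  have h : ((∑ j, ∑ x, ‖(K j *ᵥ v) x‖ ^ 2 : ℝ) : ℂ) = ((∑ x, ‖v x‖ ^ 2 : ℝ) : ℂ) := by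
    rw [Complex.ofReal_sum]
    simp_rw [key, star_mulVec]
    simp_rw [← dotProduct_mulVec, mulVec_mulVec, ← dotProduct_sum, ← sum_mulVec, hK, one_mulVec]
  exact_mod_cast h

variable (A : Finset ι)

/-- The configuration that agrees with `x` on `A` and with `z` off `A`. -/
def glue (x : {i // i ∈ A} → L) (z : {i // i ∉ A} → L) : ι → L :=
  (Equiv.piEquivPiSubtypeProd (fun i => i ∈ A) (fun _ => L)).symm (x, z)

theorem glue_of_mem (x : {i // i ∈ A} → L) (z : {i // i ∉ A} → L) {i : ι} (h : i ∈ A) :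
    glue A x z i = x ⟨i, h⟩ := by
  simp [glue, Equiv.piEquivPiSubtypeProd, h]

theorem glue_of_notMem (x : {i // i ∈ A} → L) (z : {i // i ∉ A} → L) {i : ι} (h : i ∉ A) :
    glue A x z i = z ⟨i, h⟩ := by
  simp [glue, Equiv.piEquivPiSubtypeProd, h]

theorem coeffMatrix_apply (ψ : (ι → L) → ℂ) (x : {i // i ∈ A} → L) (z : {i // i ∉ A} → L) :
    coeffMatrix ψ A x z = ψ (glue A x z) := rfl

theorem sum_sum_glue {β : Type*} [AddCommMonoid β] (g : (ι → L) → β) :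
    ∑ x, ∑ z, g (glue A x z) = ∑ y, g y := by
  rw [← Fintype.sum_prod_type']
  exact (Equiv.piEquivPiSubtypeProd (fun i => i ∈ A) (fun _ => L)).symm.sum_comp g

theorem glue_update_mem (x : {i // i ∈ A} → L) (z : {i // i ∉ A} → L) (a : {i // i ∈ A}) (l : L) :
    glue A (Function.update x a l) z = Function.update (glue A x z) a l := by
  ext1 i
  by_cases hi : i ∈ A
  · rw [glue_of_mem A _ _ hi]
    rcases eq_or_ne i a with h | h
    · subst h; simp
    · rw [Function.update_of_ne h, glue_of_mem A _ _ hi, Function.update_of_ne]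
      exact fun h' => h (congrArg Subtype.val h')
  · rw [glue_of_notMem A _ _ hi, Function.update_of_ne, glue_of_notMem A _ _ hi]
    rintro rfl; exact hi a.2

theorem glue_update_notMem (x : {i // i ∈ A} → L) (z : {i // i ∉ A} → L) (a : {i // i ∉ A})
    (l : L) : glue A x (Function.update z a l) = Function.update (glue A x z) a l := by
  ext1 i
  by_cases hi : i ∈ A
  · rw [glue_of_mem A _ _ hi, Function.update_of_ne, glue_of_mem A _ _ hi]
    rintro rfl; exact a.2 hi
  · rw [glue_of_notMem A _ _ hi]
    rcases eq_or_ne i a with h | h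
    · subst h; simp
    · rw [Function.update_of_ne h, glue_of_notMem A _ _ hi, Function.update_of_ne]
      exact fun h' => h (congrArg Subtype.val h')

/-- Locality becomes one-sided multiplication: a party in `A` acts on the row index only. A party
outside `A` acts on the column index, which is why a transpose appears in the companion lemma. -/
theorem coeffMatrix_localOp_mem {a : ι} (ha : a ∈ A) (K : Matrix L L ℂ) (v : (ι → L) → ℂ) :
    coeffMatrix (localOp a K *ᵥ v) A = localOp (⟨a, ha⟩ : {i // i ∈ A}) K * coeffMatrix v A := by
  ext x z
  have h := localOp_mulVec_apply (⟨a, ha⟩ : {i // i ∈ A}) K (fun y => coeffMatrix v A y z) x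
  rw [coeffMatrix_apply, localOp_mulVec_apply, mul_apply]
  refine Eq.trans ?_ h.symm
  refine Finset.sum_congr rfl fun l _ => ?_
  rw [coeffMatrix_apply, glue_update_mem, glue_of_mem A _ _ ha]

theorem coeffMatrix_localOp_notMem {a : ι} (ha : a ∉ A) (K : Matrix L L ℂ) (v : (ι → L) → ℂ) :
    coeffMatrix (localOp a K *ᵥ v) A =
      coeffMatrix v A * (localOp (⟨a, ha⟩ : {i // i ∉ A}) K)ᵀ := by
  ext x z
  have h := localOp_mulVec_apply (⟨a, ha⟩ : {i // i ∉ A}) K (fun y => coeffMatrix v A x y) z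
  rw [coeffMatrix_apply, localOp_mulVec_apply, mul_apply]
  simp_rw [transpose_apply, mul_comm (coeffMatrix v A x _)]
  refine Eq.trans ?_ h.symm
  refine Finset.sum_congr rfl fun l _ => ?_
  rw [coeffMatrix_apply, glue_update_notMem, glue_of_notMem A _ _ ha]

end LocalOperators

/-! ### Entropy and rank across a cut, under one-sided operations and zero padding. -/

section CutEntropy

set_option linter.unusedSectionVars false

open Matrix
open scoped ComplexOrder

variable {m n m' n' : Type*} [Fintype m] [DecidableEq m] [Fintype n] [DecidableEq n]
  [Fintype m'] [DecidableEq m'] [Fintype n'] [DecidableEq n']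

/-- The homogeneous entanglement entropy of a bipartite vector with coefficient matrix `M`. -/
noncomputable def cutEntropy (M : Matrix m n ℂ) : ℝ := homEntropy (M * Mᴴ)

theorem cutEntropy_eq (M : Matrix m n ℂ) : cutEntropy M = homEntropy (Mᴴ * M) :=
  homEntropy_mul_comm _ _

/-- An operation on the rows preserves the total reduced density of the columns, `∑ (K j * M)ᴴ * (K
j * M) = Mᴴ * M`, so concavity applies to `Mᴴ * M` rather than to `M * Mᴴ`. -/
theorem sum_cutEntropy_mul_left_le {J : Type*} [Fintype J] {K : J → Matrix m m ℂ}
    (hK : ∑ j, (K j)ᴴ * K j = 1) (M : Matrix m n ℂ) :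
    ∑ j, cutEntropy (K j * M) ≤ cutEntropy M := by
  simp_rw [cutEntropy_eq]
  refine (sum_homEntropy_le _ fun j => posSemidef_conjTranspose_mul_self (K j * M)).trans_eq ?_
  congr 1
  simp_rw [conjTranspose_mul, Matrix.mul_assoc, ← Matrix.mul_assoc (K _)ᴴ,
    ← Matrix.mul_sum, ← Matrix.sum_mul]
  rw [hK, Matrix.one_mul]

theorem sum_cutEntropy_mul_right_le {J : Type*} [Fintype J] {K : J → Matrix n n ℂ}
    (hK : ∑ j, (K j)ᴴ * K j = 1) (M : Matrix m n ℂ) :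
    ∑ j, cutEntropy (M * (K j)ᵀ) ≤ cutEntropy M := by
  unfold cutEntropy
  refine (sum_homEntropy_le _ fun j => posSemidef_self_mul_conjTranspose (M * (K j)ᵀ)).trans_eq ?_
  congr 1
  -- The completeness relation transposed; it makes the row density `M * Mᴴ` the preserved one.
  have h : ∑ j, (K j)ᵀ * ((K j)ᵀ)ᴴ = 1 := by
    have := congrArg Matrix.transpose hK
    rw [transpose_sum, transpose_one] at this
    rw [← this]
    refine Finset.sum_congr rfl fun j _ => ?_
    rw [transpose_mul]; rfl
  simp_rw [conjTranspose_mul, Matrix.mul_assoc, ← Matrix.mul_assoc (K _)ᵀ,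
    ← Matrix.mul_sum, ← Matrix.sum_mul]
  rw [h, Matrix.one_mul]

/-- `M'` is `M` padded by zeros, after injective relabelling of rows and columns. -/
def IsZeroPadding (f : m → m') (g : n → n') (M : Matrix m n ℂ) (M' : Matrix m' n' ℂ) : Prop :=
  (∀ x z, M' (f x) (g z) = M x z) ∧ ∀ x' z', M' x' z' ≠ 0 → x' ∈ Set.range f ∧ z' ∈ Set.range g

/-- The isometry induced by an injection of index sets. -/
def injMatrix (f : m → m') : Matrix m' m ℂ := of fun x' x => if x' = f x then 1 else 0

theorem injMatrix_conjTranspose_mul {f : m → m'} (hf : Function.Injective f) :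
    (injMatrix f)ᴴ * injMatrix f = 1 := by
  ext x y
  simp [injMatrix, mul_apply, one_apply, apply_ite, hf.eq_iff, eq_comm]

theorem IsZeroPadding.eq_mul {f : m → m'} {g : n → n'} (hf : Function.Injective f)
    (hg : Function.Injective g) {M : Matrix m n ℂ} {M' : Matrix m' n' ℂ}
    (h : IsZeroPadding f g M M') : M' = injMatrix f * M * (injMatrix g)ᴴ := by
  ext x' z'
  by_cases h0 : x' ∈ Set.range f ∧ z' ∈ Set.range g
  · obtain ⟨⟨x, rfl⟩, ⟨z, rfl⟩⟩ := h0
    rw [h.1]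
    simp [injMatrix, mul_apply, hf.eq_iff, hg.eq_iff, apply_ite]
  · have : M' x' z' = 0 := by
      by_contra h1; exact h0 (h.2 _ _ h1)
    rw [this]
    simp only [not_and_or, Set.mem_range, not_exists] at h0
    rcases h0 with h0 | h0
    · simp [injMatrix, mul_apply, fun x => (Ne.symm (h0 x) : x' ≠ f x)]
    · simp [injMatrix, mul_apply, fun x => (Ne.symm (h0 x) : z' ≠ g x)]

/-- Padding multiplies by isometries on both sides: one cancels inside `M' * M'ᴴ`, the other after a
cyclic exchange. -/
theorem IsZeroPadding.cutEntropy_eq {f : m → m'} {g : n → n'} (hf : Function.Injective f)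
    (hg : Function.Injective g) {M : Matrix m n ℂ} {M' : Matrix m' n' ℂ}
    (h : IsZeroPadding f g M M') : cutEntropy M' = cutEntropy M := by
  have e : M' * M'ᴴ = injMatrix f * (M * Mᴴ * (injMatrix f)ᴴ) := by
    rw [h.eq_mul hf hg]
    simp only [conjTranspose_mul, conjTranspose_conjTranspose, Matrix.mul_assoc]
    rw [← Matrix.mul_assoc (injMatrix g)ᴴ (injMatrix g), injMatrix_conjTranspose_mul hg,
      Matrix.one_mul]
  rw [cutEntropy, e, homEntropy_mul_comm, Matrix.mul_assoc, injMatrix_conjTranspose_mul hf,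
    Matrix.mul_one,
    cutEntropy]

theorem IsZeroPadding.rank_eq {f : m → m'} {g : n → n'} (hf : Function.Injective f)
    (hg : Function.Injective g) {M : Matrix m n ℂ} {M' : Matrix m' n' ℂ}
    (h : IsZeroPadding f g M M') : M'.rank = M.rank := by
  refine le_antisymm ?_ ?_
  · rw [h.eq_mul hf hg]
    exact (rank_mul_le_left _ _).trans (rank_mul_le_right _ _)
  · have : M = M'.submatrix f g := by ext x z; exact (h.1 x z).symm
    rw [this]; exact rank_submatrix_le _ _ _

end CutEntropy

/-! ### Monotonicity of entropy and Schmidt rank under LOCC. -/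

section Protocols

open Matrix
open scoped ComplexOrder

variable {ι : Type} [Fintype ι] [DecidableEq ι]

theorem trace_reducedDensity {L : Type} [Fintype L] [DecidableEq L] (ψ : (ι → L) → ℂ)
    (A : Finset ι) : (reducedDensity ψ A).trace = ((∑ x, ‖ψ x‖ ^ 2 : ℝ) : ℂ) := by
  rw [← sum_sum_glue A]
  simp [reducedDensity, trace, mul_apply, Complex.mul_conj', coeffMatrix_apply]

theorem reducedDensity_posSemidef {L : Type} [Fintype L] [DecidableEq L] (ψ : (ι → L) → ℂ)
    (A : Finset ι) : (reducedDensity ψ A).PosSemidef :=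
  posSemidef_self_mul_conjTranspose _

theorem schmidtRank_eq {L : Type} [Fintype L] [DecidableEq L] (ψ : (ι → L) → ℂ)
    (A : Finset ι) : schmidtRank ψ A = (coeffMatrix ψ A).rank :=
  rank_self_mul_conjTranspose _

theorem entanglementEntropy_eq_specEntropy {L : Type} [Fintype L] [DecidableEq L]
    (ψ : (ι → L) → ℂ) (A : Finset ι) :
    entanglementEntropy ψ A = specEntropy (reducedDensity ψ A) / Real.log 2 := by
  rw [entanglementEntropy, specEntropy_of_isHermitian (reducedDensity_isHermitian ψ A),
    Finset.sum_div, ← Finset.sum_neg_distrib]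
  refine Finset.sum_congr rfl fun i _ => ?_
  rw [Real.negMulLog, Real.logb]; ring

theorem entanglementEntropy_eq_cutEntropy {L : Type} [Fintype L] [DecidableEq L]
    {ψ : (ι → L) → ℂ} (hψ : ∑ x, ‖ψ x‖ ^ 2 = 1) (A : Finset ι) :
    entanglementEntropy ψ A = cutEntropy (coeffMatrix ψ A) / Real.log 2 := by
  have h : (coeffMatrix ψ A * (coeffMatrix ψ A)ᴴ).trace = 1 := by
    have := trace_reducedDensity ψ A
    rw [hψ] at this; exact_mod_cast this
  rw [entanglementEntropy_eq_specEntropy, cutEntropy, homEntropy, h]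
  simp [reducedDensity]

theorem sum_cutEntropy_localOp_le {L J : Type} [Fintype L] [DecidableEq L] [Fintype J]
    (A : Finset ι) (a : ι) {K : J → Matrix L L ℂ} (hK : ∑ j, (K j)ᴴ * K j = 1)
    (v : (ι → L) → ℂ) :
    ∑ j, cutEntropy (coeffMatrix (localOp a (K j) *ᵥ v) A) ≤ cutEntropy (coeffMatrix v A) := by
  by_cases ha : a ∈ A
  · simp_rw [coeffMatrix_localOp_mem A ha]
    exact sum_cutEntropy_mul_left_le (sum_localOp_conjTranspose_mul _ hK) _
  · simp_rw [coeffMatrix_localOp_notMem A ha]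
    exact sum_cutEntropy_mul_right_le (sum_localOp_conjTranspose_mul _ hK) _

theorem rank_coeffMatrix_localOp_le {L : Type} [Fintype L] [DecidableEq L]
    (A : Finset ι) (a : ι) (K : Matrix L L ℂ) (v : (ι → L) → ℂ) :
    (coeffMatrix (localOp a K *ᵥ v) A).rank ≤ (coeffMatrix v A).rank := by
  by_cases ha : a ∈ A
  · rw [coeffMatrix_localOp_mem A ha]; exact rank_mul_le_right _ _
  · rw [coeffMatrix_localOp_notMem A ha]; exact rank_mul_le_left _ _

open Kronecker in
theorem coeffMatrix_withAncillas {k : ℕ} (φ : (ι → Fin 2) → ℂ) (χ : (ι → Fin k) → ℂ)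
    (A : Finset ι) : coeffMatrix (withAncillas φ χ) A =
      Matrix.reindex (Equiv.arrowProdEquivProdArrow _ _ _).symm
        (Equiv.arrowProdEquivProdArrow _ _ _).symm (coeffMatrix φ A ⊗ₖ coeffMatrix χ A) := by
  ext x z
  have h1 : (fun i => (glue A x z i).1) = glue A (fun i => (x i).1) (fun i => (z i).1) := by
    ext1 i
    by_cases hi : i ∈ A
    · rw [glue_of_mem A _ _ hi, glue_of_mem A _ _ hi]
    · rw [glue_of_notMem A _ _ hi, glue_of_notMem A _ _ hi]
  have h2 : (fun i => (glue A x z i).2) = glue A (fun i => (x i).2) (fun i => (z i).2) := by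
    ext1 i
    by_cases hi : i ∈ A
    · rw [glue_of_mem A _ _ hi, glue_of_mem A _ _ hi]
    · rw [glue_of_notMem A _ _ hi, glue_of_notMem A _ _ hi]
  rw [coeffMatrix_apply, withAncillas, h1, h2]
  rfl

theorem sum_normSq_withAncillas {k : ℕ} (φ : (ι → Fin 2) → ℂ) (χ : (ι → Fin k) → ℂ) :
    ∑ x, ‖withAncillas φ χ x‖ ^ 2 = (∑ x, ‖φ x‖ ^ 2) * ∑ y, ‖χ y‖ ^ 2 := by
  rw [Finset.sum_mul_sum, ← Fintype.sum_prod_type']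
  rw [← (Equiv.arrowProdEquivProdArrow ι (fun _ => Fin 2) (fun _ => Fin k)).sum_comp]
  simp [withAncillas, mul_pow, Equiv.arrowProdEquivProdArrow]

-- The reduced density is a tensor product, so its entropy is the branch probability times that of
-- `φ`, plus a nonnegative contribution of the ancillas.
open Kronecker in
theorem cutEntropy_withAncillas_ge {k : ℕ} {φ : (ι → Fin 2) → ℂ} (hφ : ∑ x, ‖φ x‖ ^ 2 = 1)
    (χ : (ι → Fin k) → ℂ) (A : Finset ι) :
    (∑ x, ‖withAncillas φ χ x‖ ^ 2) * cutEntropy (coeffMatrix φ A) ≤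
      cutEntropy (coeffMatrix (withAncillas φ χ) A) := by
  rw [sum_normSq_withAncillas, hφ, one_mul]
  have e : coeffMatrix (withAncillas φ χ) A * (coeffMatrix (withAncillas φ χ) A)ᴴ =
      Matrix.reindex (Equiv.arrowProdEquivProdArrow _ _ _).symm
        (Equiv.arrowProdEquivProdArrow _ _ _).symm (reducedDensity φ A ⊗ₖ reducedDensity χ A) := by
    rw [coeffMatrix_withAncillas, reducedDensity, reducedDensity, mul_kronecker_mul,
      ← conjTranspose_kronecker, conjTranspose_reindex, reindex_apply, reindex_apply,
      reindex_apply, submatrix_mul_equiv]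
  rw [cutEntropy, cutEntropy, e, homEntropy_reindex,
    homEntropy_kronecker (reducedDensity_isHermitian _ _) (reducedDensity_isHermitian _ _),
    trace_reducedDensity, trace_reducedDensity, hφ, Complex.ofReal_re, Complex.ofReal_re, one_mul]
  exact le_add_of_nonneg_right (homEntropy_nonneg (reducedDensity_posSemidef _ _))

-- Freezing the ancillas at a configuration where `χ` does not vanish exhibits a nonzero multiple of
-- the matrix of `φ` as a submatrix.
open Kronecker in
theorem rank_coeffMatrix_withAncillas_ge {k : ℕ} (φ : (ι → Fin 2) → ℂ) {χ : (ι → Fin k) → ℂ}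
    (hχ : χ ≠ 0) (A : Finset ι) :
    (coeffMatrix φ A).rank ≤ (coeffMatrix (withAncillas φ χ) A).rank := by
  obtain ⟨y, hy⟩ := Function.ne_iff.1 hχ
  rw [coeffMatrix_withAncillas, rank_reindex]
  set x₀ : {i // i ∈ A} → Fin k := fun i => y i
  set z₀ : {i // i ∉ A} → Fin k := fun i => y i
  have hc : coeffMatrix χ A x₀ z₀ ≠ 0 := by
    have : glue A x₀ z₀ = y := by
      ext1 i
      by_cases hi : i ∈ A
      · rw [glue_of_mem A _ _ hi]
      · rw [glue_of_notMem A _ _ hi]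
    rw [coeffMatrix_apply, this]; exact hy
  have h : (coeffMatrix φ A ⊗ₖ coeffMatrix χ A).submatrix (fun x => (x, x₀)) (fun z => (z, z₀)) =
      coeffMatrix χ A x₀ z₀ • coeffMatrix φ A := by
    ext x z; simp [kroneckerMap_apply, mul_comm]
  calc (coeffMatrix φ A).rank = (coeffMatrix χ A x₀ z₀ • coeffMatrix φ A).rank :=
        (rank_smul_of_mem_nonZeroDivisors _ (mem_nonZeroDivisors_of_ne_zero hc)).symm
    _ ≤ _ := by rw [← h]; exact rank_submatrix_le _ _ _

/-- The bound is linear in the weight of a branch, so one round of the induction needs only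
conservation of probability and monotonicity of the average entropy. -/
theorem LOCCProtocol.cutEntropy_ge {k : ℕ} {φ : (ι → Fin 2) → ℂ} (hφ : ∑ x, ‖φ x‖ ^ 2 = 1)
    (A : Finset ι) (p : LOCCProtocol ι (Fin 2 × Fin k)) :
    ∀ v : (ι → Fin 2 × Fin k) → ℂ,
      p.AllBranches (fun v => ∃ χ : (ι → Fin k) → ℂ, v = withAncillas φ χ) v →
      (∑ x, ‖v x‖ ^ 2) * cutEntropy (coeffMatrix φ A) ≤ cutEntropy (coeffMatrix v A) := by
  induction p with
  | halt =>
    rintro v ⟨χ, rfl⟩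
    exact cutEntropy_withAncillas_ge hφ χ A
  | round a m K complete next ih =>
    intro v hv
    rw [← sum_normSq_mulVec (sum_localOp_conjTranspose_mul a complete) v, Finset.sum_mul]
    exact (Finset.sum_le_sum fun j _ => ih j _ (hv j)).trans
      (sum_cutEntropy_localOp_le A a complete v)

/-- Since the rank never grows, it is enough to follow one branch of nonzero probability;
conservation of probability supplies one in every round. -/
theorem LOCCProtocol.rank_ge {k : ℕ} {φ : (ι → Fin 2) → ℂ}
    (A : Finset ι) (p : LOCCProtocol ι (Fin 2 × Fin k)) :
    ∀ v : (ι → Fin 2 × Fin k) → ℂ, v ≠ 0 →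
      p.AllBranches (fun v => ∃ χ : (ι → Fin k) → ℂ, v = withAncillas φ χ) v →
      (coeffMatrix φ A).rank ≤ (coeffMatrix v A).rank := by
  induction p with
  | halt =>
    rintro v hv ⟨χ, rfl⟩
    refine rank_coeffMatrix_withAncillas_ge φ ?_ A
    rintro rfl
    exact hv (by ext x; simp [withAncillas])
  | round a m K complete next ih =>
    intro v hv0 hv
    have h := sum_normSq_mulVec (sum_localOp_conjTranspose_mul a complete) v
    have : ∃ j, localOp a (K j) *ᵥ v ≠ 0 := by
      by_contra! h0
      simp only [h0, Pi.zero_apply, norm_zero, ne_eq, OfNat.ofNat_ne_zero, not_false_eq_true,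
        zero_pow, Finset.sum_const_zero] at h
      refine hv0 (funext fun x => ?_)
      have := (Finset.sum_eq_zero_iff_of_nonneg (fun x _ => by positivity)).1 h.symm x
        (Finset.mem_univ x)
      simpa using this
    obtain ⟨j, hj⟩ := this
    exact (ih j _ hj (hv j)).trans (rank_coeffMatrix_localOp_le A a (K j) v)

theorem isZeroPadding_withAncillas_zero {k : ℕ} (ψ : (ι → Fin 2) → ℂ) (A : Finset ι) :
    IsZeroPadding (fun (x : {i // i ∈ A} → Fin 2) i => (x i, (0 : Fin (k + 1))))
      (fun (z : {i // i ∉ A} → Fin 2) i => (z i, (0 : Fin (k + 1)))) (coeffMatrix ψ A)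
      (coeffMatrix (withAncillas ψ (Pi.single (fun _ => 0) 1)) A) := by
  constructor
  · intro x z
    rw [coeffMatrix_apply, coeffMatrix_apply, withAncillas]
    have h : ∀ i, glue A (fun i => (x i, (0 : Fin (k + 1)))) (fun i => (z i, 0)) i =
        (glue A x z i, 0) := by
      intro i
      by_cases hi : i ∈ A
      · rw [glue_of_mem A _ _ hi, glue_of_mem A _ _ hi]
      · rw [glue_of_notMem A _ _ hi, glue_of_notMem A _ _ hi]
    simp [h]
  · intro x z h
    rw [coeffMatrix_apply, withAncillas] at h
    have h1 := right_ne_zero_of_mul h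
    rw [Pi.single_apply] at h1
    have h2 : (fun i => (glue A x z i).2) = fun _ => 0 := by
      by_contra hne; simp [hne] at h1
    constructor
    · refine ⟨fun i => (x i).1, funext fun i => ?_⟩
      have := congrFun h2 i
      simp only [glue_of_mem A _ _ i.2] at this
      exact Prod.ext rfl this.symm
    · refine ⟨fun i => (z i).1, funext fun i => ?_⟩
      have := congrFun h2 i
      simp only [glue_of_notMem A _ _ i.2] at this
      exact Prod.ext rfl this.symm

theorem sum_normSq_withAncillas_zero {k : ℕ} (ψ : (ι → Fin 2) → ℂ) :
    ∑ x, ‖withAncillas ψ (Pi.single (fun _ => (0 : Fin (k + 1))) 1) x‖ ^ 2 = ∑ x, ‖ψ x‖ ^ 2 := by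
  rw [sum_normSq_withAncillas]
  simp [Pi.single_apply, apply_ite]

variable {N n : ℕ}

theorem LOCCConvertible.cutEntropy_le {ψ φ : (Fin N → Fin 2) → ℂ} (hψ : ∑ x, ‖ψ x‖ ^ 2 = 1)
    (hφ : ∑ x, ‖φ x‖ ^ 2 = 1) (h : LOCCConvertible ψ φ) (A : Finset (Fin N)) :
    cutEntropy (coeffMatrix φ A) ≤ cutEntropy (coeffMatrix ψ A) := by
  obtain ⟨k, p, hp⟩ := h
  have := p.cutEntropy_ge hφ A _ hp
  rwa [sum_normSq_withAncillas_zero, hψ, one_mul,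
    (isZeroPadding_withAncillas_zero ψ A).cutEntropy_eq] at this
  all_goals
    intro x y hxy
    ext1 i
    exact congrArg Prod.fst (congrFun hxy i)

theorem LOCCConvertible.rank_le {ψ φ : (Fin N → Fin 2) → ℂ} (hψ : ∑ x, ‖ψ x‖ ^ 2 = 1)
    (h : LOCCConvertible ψ φ) (A : Finset (Fin N)) :
    (coeffMatrix φ A).rank ≤ (coeffMatrix ψ A).rank := by
  obtain ⟨k, p, hp⟩ := h
  have := p.rank_ge A _ (fun h0 => by
    have := sum_normSq_withAncillas_zero (k := k) ψ
    rw [h0, hψ] at this; simp at this) hp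
  rwa [(isZeroPadding_withAncillas_zero ψ A).rank_eq] at this
  all_goals
    intro x y hxy
    ext1 i
    exact congrArg Prod.fst (congrFun hxy i)

/-- Extension of a configuration by `0` along an embedding, on a subset of the targets. -/
noncomputable def extendZero {p : Fin n → Prop} {q : Fin N → Prop} (f : Fin n ↪ Fin N)
    (hpq : ∀ j, q (f j) → p j) (x : {j // p j} → Fin 2) : {i // q i} → Fin 2 :=
  open Classical in
  fun i => if h : ∃ j, f j = i then x ⟨h.choose, hpq _ (by rw [h.choose_spec]; exact i.2)⟩ else 0

theorem extendZero_apply {p : Fin n → Prop} {q : Fin N → Prop} (f : Fin n ↪ Fin N)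
    (hpq : ∀ j, q (f j) → p j) (x : {j // p j} → Fin 2) (j : Fin n) (hj : q (f j)) :
    extendZero f hpq x ⟨f j, hj⟩ = x ⟨j, hpq j hj⟩ := by
  have h : ∃ j', f j' = f j := ⟨j, rfl⟩
  rw [extendZero, dif_pos h]
  congr 2
  exact f.injective h.choose_spec

theorem extendZero_of_notMem {p : Fin n → Prop} {q : Fin N → Prop} (f : Fin n ↪ Fin N)
    (hpq : ∀ j, q (f j) → p j) (x : {j // p j} → Fin 2) (i : {i // q i})
    (hi : (i : Fin N) ∉ Set.range f) : extendZero f hpq x i = 0 := by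
  rw [extendZero, dif_neg]
  exact hi

theorem extendZero_injective {p : Fin n → Prop} {q : Fin N → Prop} (f : Fin n ↪ Fin N)
    (hpq : ∀ j, q (f j) ↔ p j) :
    Function.Injective (extendZero f fun j => (hpq j).1) := by
  intro x y hxy
  ext1 j
  have := congrFun hxy ⟨f j, (hpq j).2 j.2⟩
  rwa [extendZero_apply, extendZero_apply] at this

theorem extendZero_restrict {p : Fin n → Prop} {q : Fin N → Prop} (f : Fin n ↪ Fin N)
    (hpq : ∀ j, q (f j) ↔ p j) (x : {i // q i} → Fin 2)
    (hx : ∀ i : {i // q i}, (i : Fin N) ∉ Set.range f → x i = 0) :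
    extendZero f (fun j => (hpq j).1) (fun j => x ⟨f j, (hpq j).2 j.2⟩) = x := by
  ext1 ⟨i, hi⟩
  by_cases h : i ∈ Set.range f
  · obtain ⟨j, rfl⟩ := h
    rw [extendZero_apply]
  · rw [extendZero_of_notMem _ _ _ _ h, hx _ h]

/-- The trace of a cut on the output qubits. -/
def pullback (f : Fin n ↪ Fin N) (A : Finset (Fin N)) : Finset (Fin n) :=
  Finset.univ.filter fun j => f j ∈ A

theorem mem_pullback (f : Fin n ↪ Fin N) (A : Finset (Fin N)) (j : Fin n) :
    j ∈ pullback f A ↔ f j ∈ A := by simp [pullback]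

/-- The other qubits are frozen at `0`, so a cut of the large system sees exactly the block of `φ`
across the induced cut. -/
theorem isZeroPadding_placeOn (f : Fin n ↪ Fin N) (φ : (Fin n → Fin 2) → ℂ)
    (A : Finset (Fin N)) :
    IsZeroPadding (extendZero f fun j => (mem_pullback f A j).2)
      (extendZero f fun j => (not_congr (mem_pullback f A j)).2)
      (coeffMatrix φ (pullback f A)) (coeffMatrix (placeOn f φ) A) := by
  constructor
  · intro x z
    rw [coeffMatrix_apply, coeffMatrix_apply, placeOn, if_pos]
    · congr 1
      ext1 j
      by_cases hj : f j ∈ A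
      · rw [glue_of_mem A _ _ hj, glue_of_mem _ _ _ ((mem_pullback f A j).2 hj), extendZero_apply]
      · rw [glue_of_notMem A _ _ hj,
          glue_of_notMem _ _ _ ((not_congr (mem_pullback f A j)).2 hj), extendZero_apply]
    · intro i hi
      by_cases hj : i ∈ A
      · rw [glue_of_mem A _ _ hj, extendZero_of_notMem _ _ _ _ hi]
      · rw [glue_of_notMem A _ _ hj, extendZero_of_notMem _ _ _ _ hi]
  · intro x z h
    rw [coeffMatrix_apply, placeOn] at h
    have h0 : ∀ i, i ∉ Set.range f → glue A x z i = 0 := by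
      by_contra hne; exact h (if_neg hne)
    constructor
    · refine ⟨_, extendZero_restrict f (fun j => (mem_pullback f A j).symm) x fun i hi => ?_⟩
      have := h0 i hi
      rwa [glue_of_mem A _ _ i.2] at this
    · refine ⟨_, extendZero_restrict f (fun j => (not_congr (mem_pullback f A j)).symm) z
        fun i hi => ?_⟩
      have := h0 i hi
      rwa [glue_of_notMem A _ _ i.2] at this

theorem sum_normSq_placeOn (f : Fin n ↪ Fin N) (φ : (Fin n → Fin 2) → ℂ) :
    ∑ x, ‖placeOn f φ x‖ ^ 2 = ∑ x, ‖φ x‖ ^ 2 := by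
  classical
  let g : (Fin n → Fin 2) → Fin N → Fin 2 := fun y i =>
    if h : ∃ j, f j = i then y h.choose else 0
  have hg : ∀ y j, g y (f j) = y j := by
    intro y j
    have h : ∃ j', f j' = f j := ⟨j, rfl⟩
    simp only [g, dif_pos h]
    rw [f.injective h.choose_spec]
  have hg0 : ∀ y, ∀ i ∉ Set.range f, g y i = 0 := fun y i hi => dif_neg hi
  symm
  refine Fintype.sum_of_injective g ?_ _ _ ?_ ?_
  · intro y y' h
    ext1 j
    rw [← hg y, h, hg]
  · intro x hx
    rw [placeOn, if_neg]
    · simp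
    · intro h0
      refine hx ⟨fun j => x (f j), funext fun i => ?_⟩
      by_cases hi : i ∈ Set.range f
      · obtain ⟨j, rfl⟩ := hi
        exact hg (fun j => x (f j)) j
      · exact (hg0 (fun j => x (f j)) _ hi).trans (h0 i hi).symm
  · intro y
    rw [placeOn, if_pos (hg0 y)]
    simp_rw [hg]

theorem entanglementEntropy_pullback_le {ψ : QubitState N} {φ : QubitState n} {f : Fin n ↪ Fin N}
    (h : LOCCConvertible ψ.amp (placeOn f φ.amp)) (A : Finset (Fin N)) :
    entanglementEntropy φ.amp (pullback f A) ≤ entanglementEntropy ψ.amp A := by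
  rw [entanglementEntropy_eq_cutEntropy φ.normalized, entanglementEntropy_eq_cutEntropy ψ.normalized]
  refine div_le_div_of_nonneg_right ?_ (Real.log_nonneg one_le_two)
  have hn : ∑ x, ‖placeOn f φ.amp x‖ ^ 2 = 1 := by rw [sum_normSq_placeOn, φ.normalized]
  rw [← (isZeroPadding_placeOn f φ.amp A).cutEntropy_eq]
  · exact h.cutEntropy_le ψ.normalized hn A
  · exact extendZero_injective f fun j => (mem_pullback f A j).symm
  · exact extendZero_injective f fun j => (not_congr (mem_pullback f A j)).symm

theorem schmidtRank_pullback_le {ψ : QubitState N} {φ : QubitState n} {f : Fin n ↪ Fin N}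
    (h : LOCCConvertible ψ.amp (placeOn f φ.amp)) (A : Finset (Fin N)) :
    schmidtRank φ.amp (pullback f A) ≤ schmidtRank ψ.amp A := by
  rw [schmidtRank_eq, schmidtRank_eq, ← (isZeroPadding_placeOn f φ.amp A).rank_eq]
  · exact h.rank_le ψ.normalized A
  · exact extendZero_injective f fun j => (mem_pullback f A j).symm
  · exact extendZero_injective f fun j => (not_congr (mem_pullback f A j)).symm

theorem entanglementEntropy_le_logb_schmidtRank (ψ : QubitState n) (A : Finset (Fin n)) :
    entanglementEntropy ψ.amp A ≤ Real.logb 2 (schmidtRank ψ.amp A) := by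
  rw [entanglementEntropy_eq_specEntropy, Real.logb]
  refine div_le_div_of_nonneg_right (specEntropy_le_log_rank (reducedDensity_posSemidef _ _) ?_)
    (Real.log_nonneg one_le_two)
  rw [trace_reducedDensity, ψ.normalized, Complex.ofReal_one]

end Protocols

/-! ### From subcubic trees to hierarchical decompositions. -/

section Trees

set_option linter.unusedSectionVars false

variable {V : Type*} {G : SimpleGraph V}

/-- The component of `u` after deletion of the edge `uv`. -/
def edgeComponent (G : SimpleGraph V) (u v : V) : Set V :=
  {w | (G.deleteEdges {s(u, v)}).Reachable u w}

theorem self_mem_edgeComponent (u v : V) : u ∈ edgeComponent G u v :=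
  SimpleGraph.Reachable.refl _

theorem edgeComponent_of_adj {u v w w' : V} (hw : w ∈ edgeComponent G u v) (h : G.Adj w w')
    (hne : s(w, w') ≠ s(u, v)) : w' ∈ edgeComponent G u v := by
  refine SimpleGraph.Reachable.trans hw (SimpleGraph.Adj.reachable ?_)
  rw [SimpleGraph.deleteEdges_adj]
  exact ⟨h, hne⟩

theorem edgeComponent_induction {u v : V} {p : V → Prop} (h0 : p u)
    (h1 : ∀ w w', w ∈ edgeComponent G u v → p w → G.Adj w w' → s(w, w') ≠ s(u, v) → p w') :
    ∀ w ∈ edgeComponent G u v, p w := by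
  intro w hw
  rw [edgeComponent, Set.mem_ofPred_eq, SimpleGraph.reachable_iff_reflTransGen] at hw
  induction hw with
  | refl => exact h0
  | tail hab hbc ih =>
    rw [SimpleGraph.deleteEdges_adj] at hbc
    exact h1 _ _ ((SimpleGraph.reachable_iff_reflTransGen _ _).2 hab) ih hbc.1 hbc.2

theorem notMem_edgeComponent (hG : G.IsTree) {u v : V} (h : G.Adj u v) :
    v ∉ edgeComponent G u v :=
  SimpleGraph.isBridge_iff.1 (SimpleGraph.isAcyclic_iff_forall_adj_isBridge.1 hG.isAcyclic h)

theorem edgeComponent_compl (hG : G.IsTree) {u v : V} (h : G.Adj u v) :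
    edgeComponent G v u = (edgeComponent G u v)ᶜ := by
  ext w
  constructor
  · intro hw hw'
    rw [edgeComponent, Sym2.eq_swap] at hw
    exact notMem_edgeComponent hG h (SimpleGraph.Reachable.trans hw' hw.symm)
  · intro hw
    have key : w ∈ edgeComponent G u v ∨ w ∈ edgeComponent G v u := by
      have := (SimpleGraph.reachable_iff_reflTransGen _ _).1 (hG.connected.preconnected u w)
      clear hw
      induction this with
      | refl => exact Or.inl (self_mem_edgeComponent _ _)
      | @tail b c _ hbc ih =>
        by_cases he : s(b, c) = s(u, v)
        · rcases Sym2.eq_iff.1 he with ⟨rfl, rfl⟩ | ⟨rfl, rfl⟩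
          · exact Or.inr (self_mem_edgeComponent _ _)
          · exact Or.inl (self_mem_edgeComponent _ _)
        · rcases ih with ih | ih
          · exact Or.inl (edgeComponent_of_adj ih hbc he)
          · exact Or.inr (edgeComponent_of_adj ih hbc (by rwa [Sym2.eq_swap (a := v)]))
    exact key.resolve_left hw

/-- The branch at `x` avoids `u`, so it cannot use the edge `uv`. -/
theorem edgeComponent_subset (hG : G.IsTree) {u v x : V} (hx : G.Adj x u) (hxv : x ≠ v) :
    edgeComponent G x u ⊆ edgeComponent G u v := by
  refine edgeComponent_induction ?_ ?_
  · refine edgeComponent_of_adj (self_mem_edgeComponent _ _) hx.symm ?_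
    rw [Ne, Sym2.eq_iff]
    rintro (⟨_, h⟩ | ⟨_, rfl⟩)
    · exact hxv h
    · exact hx.ne rfl
  · intro w w' hw ih hww' hne
    refine edgeComponent_of_adj ih hww' fun he => ?_
    have hw' := edgeComponent_of_adj hw hww' hne
    rcases Sym2.eq_iff.1 he with ⟨rfl, rfl⟩ | ⟨rfl, rfl⟩
    · exact notMem_edgeComponent hG hx hw
    · exact notMem_edgeComponent hG hx hw'

/-- Take for `x` the neighbour through which a walk from `u` to `w` leaves `u` for the last time. -/
theorem exists_of_mem_edgeComponent {u v w : V} (hw : w ∈ edgeComponent G u v) (hwu : w ≠ u) :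
    ∃ x, G.Adj x u ∧ x ≠ v ∧ w ∈ edgeComponent G x u := by
  revert hwu
  refine edgeComponent_induction (p := fun w => w ≠ u →
    ∃ x, G.Adj x u ∧ x ≠ v ∧ w ∈ edgeComponent G x u) (fun h => (h rfl).elim) ?_ w hw
  intro w w' _ ih hww' hne hw'u
  by_cases hwu : w = u
  · subst hwu
    refine ⟨w', hww'.symm, ?_, self_mem_edgeComponent _ _⟩
    rintro rfl; exact hne rfl
  · obtain ⟨x, hx, hxv, hwx⟩ := ih hwu
    refine ⟨x, hx, hxv, edgeComponent_of_adj hwx hww' fun he => ?_⟩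
    rcases Sym2.eq_iff.1 he with ⟨_, h⟩ | ⟨h, _⟩
    · exact hw'u h
    · exact hwu h

theorem edgeComponent_disjoint (hG : G.IsTree) {u x y : V} (hx : G.Adj x u) (hy : G.Adj y u)
    (hxy : x ≠ y) : Disjoint (edgeComponent G x u) (edgeComponent G y u) := by
  have h := edgeComponent_subset hG hy hxy.symm
  rw [edgeComponent_compl hG hx] at h
  exact (Set.disjoint_of_subset_left h disjoint_compl_left).symm

/-- A hierarchical binary decomposition of a set of leaves, all of whose clusters satisfy `P`. -/
inductive BranchDecomp {ι : Type} [DecidableEq ι] (P : Finset ι → Prop) : Finset ι → Prop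
  | leaf (i : ι) (h : P {i}) : BranchDecomp P {i}
  | node {A B : Finset ι} (hAB : Disjoint A B) (hA : BranchDecomp P A) (hB : BranchDecomp P B)
      (h : P (A ∪ B)) : BranchDecomp P (A ∪ B)

namespace SubcubicTree

variable {ι : Type} [Fintype ι] [DecidableEq ι] (T : SubcubicTree ι)

theorem mem_side {u v : Fin T.numVertices} (h : T.graph.Adj u v) (i : ι) :
    i ∈ T.side ⟨(u, v), h⟩ ↔ (T.leaf i : Fin T.numVertices) ∈ edgeComponent T.graph u v := by
  simp only [side, Finset.mem_filter, Finset.mem_univ, true_and]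
  rfl

theorem side_symm (d : T.graph.Dart) : T.side d.symm = (T.side d)ᶜ := by
  obtain ⟨⟨u, v⟩, h⟩ := d
  ext i
  rw [Finset.mem_compl, T.mem_side h]
  change i ∈ T.side ⟨(v, u), h.symm⟩ ↔ _
  rw [T.mem_side h.symm, edgeComponent_compl T.isTree h]
  rfl

theorem side_of_leaf {v : Fin T.numVertices} {i : ι} (h : T.graph.Adj (T.leaf i) v) :
    T.side ⟨(T.leaf i, v), h⟩ = {i} := by
  ext j
  rw [T.mem_side h, Finset.mem_singleton]
  constructor
  · intro hj
    by_contra hne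
    obtain ⟨x, hx, hxv, -⟩ := exists_of_mem_edgeComponent hj fun he =>
      hne (T.leaf.injective (Subtype.ext he))
    obtain ⟨y, hy⟩ := Set.ncard_eq_one.1 (T.leaf i).2
    have h1 : x ∈ T.graph.neighborSet (T.leaf i) := hx.symm
    have h2 : v ∈ T.graph.neighborSet (T.leaf i) := h
    rw [hy] at h1 h2
    exact hxv (h1.trans h2.symm)
  · rintro rfl; exact self_mem_edgeComponent _ _

/-- At a vertex `u` of degree three, entered from `v`, the branches at the two other neighbours
partition the leaves, since `u` itself carries no label. Each branch omits `u`, so the induction on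
the size of the component proceeds. -/
theorem branchDecomp_side_aux (n : ℕ) : ∀ (u v : Fin T.numVertices) (h : T.graph.Adj u v),
    (edgeComponent T.graph u v).ncard ≤ n →
      BranchDecomp (fun S => ∃ d, S = T.side d) (T.side ⟨(u, v), h⟩) := by
  induction n with
  | zero =>
    intro u v h hn
    rw [Nat.le_zero, Set.ncard_eq_zero] at hn
    exact (Set.eq_empty_iff_forall_notMem.1 hn u (self_mem_edgeComponent _ _)).elim
  | succ n ih =>
    intro u v h hn
    have hv : v ∈ T.graph.neighborSet u := h
    rcases T.degree_eq u with h1 | h3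
    · obtain ⟨i, hi⟩ := T.leaf.surjective ⟨u, h1⟩
      obtain rfl : (T.leaf i : Fin T.numVertices) = u := congrArg Subtype.val hi
      have hs := T.side_of_leaf h
      rw [hs]
      exact BranchDecomp.leaf i ⟨_, hs.symm⟩
    · have h2 : (T.graph.neighborSet u \ {v}).ncard = 2 := by
        rw [Set.ncard_sdiff_singleton_of_mem hv, h3]
      obtain ⟨x, y, hxy, hset⟩ := Set.ncard_eq_two.1 h2
      have hx : x ∈ T.graph.neighborSet u \ {v} := by rw [hset]; simp
      have hy : y ∈ T.graph.neighborSet u \ {v} := by rw [hset]; simp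
      have hxu : T.graph.Adj x u := SimpleGraph.Adj.symm hx.1
      have hyu : T.graph.Adj y u := SimpleGraph.Adj.symm hy.1
      have hlt : ∀ z, T.graph.Adj z u → z ≠ v → (edgeComponent T.graph z u).ncard ≤ n := by
        intro z hz hzv
        have : (edgeComponent T.graph z u).ncard < (edgeComponent T.graph u v).ncard := by
          refine Set.ncard_lt_ncard ⟨edgeComponent_subset T.isTree hz hzv, fun hsub => ?_⟩
          exact notMem_edgeComponent T.isTree hz (hsub (self_mem_edgeComponent _ _))
        omega
      have hunion : T.side ⟨(u, v), h⟩ = T.side ⟨(x, u), hxu⟩ ∪ T.side ⟨(y, u), hyu⟩ := by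
        ext i
        rw [Finset.mem_union, T.mem_side, T.mem_side, T.mem_side]
        constructor
        · intro hi
          obtain ⟨z, hz, hzv, hiz⟩ := exists_of_mem_edgeComponent hi (fun he => by
            have := (T.leaf i).2
            rw [he, h3] at this; omega)
          have : z ∈ T.graph.neighborSet u \ {v} := ⟨hz.symm, hzv⟩
          rw [hset] at this
          rcases this with rfl | rfl
          · exact Or.inl hiz
          · exact Or.inr hiz
        · rintro (hi | hi)
          · exact edgeComponent_subset T.isTree hxu hx.2 hi
          · exact edgeComponent_subset T.isTree hyu hy.2 hi
      rw [hunion]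
      refine BranchDecomp.node ?_ (ih x u hxu (hlt x hxu hx.2)) (ih y u hyu (hlt y hyu hy.2))
        ⟨_, hunion.symm⟩
      rw [Finset.disjoint_left]
      intro i hi hi'
      rw [T.mem_side] at hi hi'
      exact Set.disjoint_left.1 (edgeComponent_disjoint T.isTree hxu hyu hxy) hi hi'

/-- The tree rooted at the leaf `i₀` decomposes the set of all other leaves. -/
theorem branchDecomp (i₀ : ι) :
    BranchDecomp (fun S => ∃ d, S = T.side d) (Finset.univ.erase i₀) := by
  obtain ⟨u, hu⟩ := Set.ncard_eq_one.1 (T.leaf i₀).2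
  have hadj : T.graph.Adj (T.leaf i₀) u := by
    have : u ∈ T.graph.neighborSet (T.leaf i₀) := by rw [hu]; rfl
    exact this
  have h := T.branchDecomp_side_aux _ u (T.leaf i₀) hadj.symm le_rfl
  have hs : T.side ⟨(u, T.leaf i₀), hadj.symm⟩ = Finset.univ.erase i₀ := by
    have := T.side_symm ⟨(T.leaf i₀, u), hadj⟩
    rw [T.side_of_leaf hadj] at this
    refine Eq.trans this ?_
    ext j; simp
  rwa [hs] at h

end SubcubicTree

/-- A caterpillar, splitting off one leaf at a time; it serves to show that subcubic trees exist. -/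
theorem BranchDecomp.of_forall {ι : Type} [DecidableEq ι] {P : Finset ι → Prop} (hP : ∀ A, P A)
    {S : Finset ι} (hS : S.Nonempty) : BranchDecomp P S := by
  induction hS using Finset.Nonempty.cons_induction with
  | singleton a => exact .leaf a (hP _)
  | cons a s ha hs ih =>
    rw [Finset.cons_eq_insert, Finset.insert_eq]
    exact .node (by simpa using ha) (.leaf a (hP _)) ih (hP _)

/-- Restriction of a decomposition to a subset of the leaves. -/
theorem BranchDecomp.pullback {N n : ℕ} {P : Finset (Fin N) → Prop} {S : Finset (Fin N)}
    (h : BranchDecomp P S) (f : Fin n ↪ Fin N) (hne : (pullback f S).Nonempty) :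
    BranchDecomp (fun A => ∃ B, P B ∧ A = _root_.pullback f B) (_root_.pullback f S) := by
  induction h with
  | leaf i h =>
    obtain ⟨j, hj⟩ := hne
    rw [mem_pullback, Finset.mem_singleton] at hj
    have : _root_.pullback f {i} = {j} := by
      ext k
      rw [mem_pullback, Finset.mem_singleton, Finset.mem_singleton, ← hj, f.injective.eq_iff]
    rw [this]
    exact .leaf j ⟨_, h, this.symm⟩
  | @node A B hAB _ _ h ihA ihB =>
    have hun : _root_.pullback f (A ∪ B) = _root_.pullback f A ∪ _root_.pullback f B := by
      ext k; simp [mem_pullback]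
    -- A node one of whose children loses all its leaves is suppressed in favour of the other child.
    rcases (_root_.pullback f A).eq_empty_or_nonempty with hA | hA
    · rw [hun, hA, Finset.empty_union] at hne ⊢
      exact ihB hne
    · rcases (_root_.pullback f B).eq_empty_or_nonempty with hB | hB
      · rw [hun, hB, Finset.union_empty]
        exact ihA hA
      · rw [hun]
        refine .node ?_ (ihA hA) (ihB hB) ⟨_, h, hun.symm⟩
        rw [Finset.disjoint_left] at hAB ⊢
        intro k hk hk'
        rw [mem_pullback] at hk hk'
        exact hAB hk hk'

/-- A decomposition of a large set has a cluster of size between `a` and `2 a`. -/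
theorem BranchDecomp.exists_balanced {ι : Type} [DecidableEq ι] {P : Finset ι → Prop}
    {S : Finset ι} (h : BranchDecomp P S) {a : ℕ} (ha : a ≤ S.card) :
    ∃ A, P A ∧ a ≤ A.card ∧ A.card ≤ 2 * a + 1 := by
  induction h with
  | leaf i h => exact ⟨_, h, ha, by simp⟩
  | @node A B hAB _ _ h ihA ihB =>
    by_cases hA : a ≤ A.card
    · exact ihA hA
    · by_cases hB : a ≤ B.card
      · exact ihB hB
      -- Both children have fewer than `a` leaves. The `+ 1` in the bound is needed only for a
      -- single leaf with `a = 0`.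
      · refine ⟨_, h, ha, ?_⟩
        rw [Finset.card_union_of_disjoint hAB]; omega

end Trees

/-! ### Rooted trees given by parent functions, as subcubic trees. -/

section ParentFunctions

variable {W : Type*}

/-- `u` is a descendant of `v` (or equal to it). -/
def Below (par : W → Option W) (u v : W) : Prop :=
  Relation.ReflTransGen (fun a b => par a = some b) u v

theorem Below.map {W' : Type*} {par : W → Option W} {par' : W' → Option W'} (e : W → W')
    (he : ∀ a b, par a = some b → par' (e a) = some (e b)) {u v : W} (huv : Below par u v) :
    Below par' (e u) (e v) := by
  induction huv with
  | refl => exact Relation.ReflTransGen.refl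
  | tail _ hbc ih => exact Relation.ReflTransGen.tail ih (he _ _ hbc)

/-- `par` is the parent function of a tree with root `r`; `h` decreases towards the root. -/
structure IsRootedTree (par : W → Option W) (h : W → ℕ) (r : W) : Prop where
  par_root : par r = none
  below_root : ∀ v, Below par v r
  height : ∀ v w, par v = some w → h w < h v

theorem IsRootedTree.par_eq_none_iff {par : W → Option W} {h : W → ℕ} {r : W}
    (hT : IsRootedTree par h r) (v : W) : par v = none ↔ v = r := by
  refine ⟨fun hv => ?_, fun hv => hv ▸ hT.par_root⟩
  rcases Relation.ReflTransGen.cases_head (hT.below_root v) with h | ⟨c, hc, _⟩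
  · exact h
  · rw [hv] at hc; cases hc

theorem IsRootedTree.height_le {par : W → Option W} {h : W → ℕ} {r : W}
    (hT : IsRootedTree par h r) {u v : W} (huv : Below par u v) : h v ≤ h u := by
  induction huv with
  | refl => exact le_rfl
  | tail _ hbc ih => exact (hT.height _ _ hbc).le.trans ih

/-- The graph that joins every vertex to its parent. -/
def parentGraph (par : W → Option W) : SimpleGraph W :=
  SimpleGraph.fromRel fun a b => par a = some b

variable {par : W → Option W} {h : W → ℕ} {r : W}

theorem IsRootedTree.adj_iff (hT : IsRootedTree par h r) (a b : W) :
    (parentGraph par).Adj a b ↔ par a = some b ∨ par b = some a := by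
  rw [parentGraph, SimpleGraph.fromRel_adj, and_iff_right_iff_imp]
  rintro (hab | hab) rfl
  · exact lt_irrefl _ (hT.height _ _ hab)
  · exact lt_irrefl _ (hT.height _ _ hab)

/-- Among edges other than the deleted one, a step down stays below `v`, and so does a step up from
a proper descendant of `v`. Sides of edges thus become sets of descendants. -/
theorem IsRootedTree.edgeComponent_eq (hT : IsRootedTree par h r) {v w : W}
    (hvw : par v = some w) : edgeComponent (parentGraph par) v w = {x | Below par x v} := by
  ext x
  constructor
  · refine edgeComponent_induction (p := fun x => Below par x v) Relation.ReflTransGen.refl ?_ x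
    intro a b _ ha hab hne
    rcases (hT.adj_iff a b).1 hab with hp | hp
    · rcases Relation.ReflTransGen.cases_head ha with rfl | ⟨c, hc, hcv⟩
      · rw [hvw, Option.some_inj] at hp
        exact (hne (by rw [hp])).elim
      · rw [hp, Option.some_inj] at hc
        rwa [hc]
    · exact Relation.ReflTransGen.head hp ha
  · intro hx
    induction hx using Relation.ReflTransGen.head_induction_on with
    | refl => exact self_mem_edgeComponent _ _
    | @head a c hac hcv ih =>
      by_cases hav : a = v
      · subst hav; exact self_mem_edgeComponent _ _
      · refine edgeComponent_of_adj ih ((hT.adj_iff c a).2 (Or.inr hac)) fun he => ?_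
        rcases Sym2.eq_iff.1 he with ⟨rfl, rfl⟩ | ⟨_, h2⟩
        · exact lt_asymm (hT.height _ _ hvw) (hT.height _ _ hac)
        · exact hav h2

/-- Every vertex reaches the root, and every edge is a bridge because heights forbid a parent from
lying below its child. -/
theorem IsRootedTree.isTree (hT : IsRootedTree par h r) : (parentGraph par).IsTree := by
  have hreach : ∀ x, (parentGraph par).Reachable x r := by
    intro x
    have := hT.below_root x
    induction this using Relation.ReflTransGen.head_induction_on with
    | refl => exact SimpleGraph.Reachable.refl _
    | head hac _ ih => exact (SimpleGraph.Adj.reachable ((hT.adj_iff _ _).2 (Or.inl hac))).trans ih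
  have hbr : ∀ v w, par v = some w → w ∉ edgeComponent (parentGraph par) v w := by
    intro v w hvw hw
    rw [hT.edgeComponent_eq hvw] at hw
    exact absurd (hT.height_le hw) (not_le.2 (hT.height _ _ hvw))
  have : Nonempty W := ⟨r⟩
  refine ⟨⟨fun x y => (hreach x).trans (hreach y).symm⟩, ?_⟩
  rw [SimpleGraph.isAcyclic_iff_forall_adj_isBridge]
  intro v w hvw
  rcases (hT.adj_iff v w).1 hvw with hp | hp
  · exact SimpleGraph.isBridge_iff.2 (hbr v w hp)
  · rw [Sym2.eq_swap]
    exact SimpleGraph.isBridge_iff.2 (hbr w v hp)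

theorem IsRootedTree.neighborSet_ncard [Finite W] (hT : IsRootedTree par h r) (v : W) :
    ((parentGraph par).neighborSet v).ncard =
      {u | par u = some v}.ncard + {w | par v = some w}.ncard := by
  rw [← Set.ncard_union_eq]
  · congr 1
    ext u
    simp only [SimpleGraph.mem_neighborSet, hT.adj_iff, Set.mem_union, Set.mem_ofPred_eq]
    exact or_comm
  · rw [Set.disjoint_left]
    intro u hu hu'
    exact lt_asymm (hT.height _ _ hu) (hT.height _ _ hu')

theorem IsRootedTree.parent_ncard (hT : IsRootedTree par h r) (v : W) (hv : v ≠ r) :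
    {w | par v = some w}.ncard = 1 := by
  rcases hp : par v with _ | w
  · exact (hv ((hT.par_eq_none_iff v).1 hp)).elim
  · simp

/-- The recursive construction lives on `Option` and sigma types, whereas a `SubcubicTree` has
vertices in `Fin m`. -/
theorem IsRootedTree.transport {W' : Type*} (hT : IsRootedTree par h r) (e : W ≃ W') :
    IsRootedTree (fun x => (par (e.symm x)).map e) (fun x => h (e.symm x)) (e r) := by
  refine ⟨by simp [hT.par_root], fun v => ?_, fun v w hvw => ?_⟩
  · have := Below.map (par' := fun x => (par (e.symm x)).map e) e
      (fun a b hab => by simp [hab]) (hT.below_root (e.symm v))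
    simpa using this
  · obtain ⟨c, hc, rfl⟩ := Option.map_eq_some_iff.1 hvw
    simpa using hT.height _ _ hc

theorem below_transport_iff {W' : Type*} (par : W → Option W) (e : W ≃ W') (u v : W) :
    Below (fun x => (par (e.symm x)).map e) (e u) (e v) ↔ Below par u v := by
  constructor
  · intro hb
    have := Below.map (par' := par) e.symm (fun a b hab => by
      obtain ⟨c, hc, rfl⟩ := Option.map_eq_some_iff.1 hab
      simpa using hc) hb
    simpa using this
  · exact Below.map e (fun a b hab => by simp [hab])

/-- A rooted tree whose root and childless vertices are labelled by `ι`, the root having one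
child and every other vertex two or none, is a subcubic tree. -/
theorem IsRootedTree.exists_subcubicTree_fin {ι : Type} [Fintype ι] [DecidableEq ι] {m : ℕ}
    {par : Fin m → Option (Fin m)} {h : Fin m → ℕ} {r : Fin m} (hT : IsRootedTree par h r)
    (hr : {u | par u = some r}.ncard = 1)
    (hc : ∀ v ≠ r, {u | par u = some v}.ncard = 0 ∨ {u | par u = some v}.ncard = 2)
    (l : ι → Fin m) (hl : Function.Injective l)
    (hl' : ∀ v, v ∈ Set.range l ↔ v = r ∨ {u | par u = some v}.ncard = 0) {P : Finset ι → Prop}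
    (hP : ∀ v ≠ r, ∃ A, P A ∧ ∀ i, i ∈ A ↔ Below par (l i) v) :
    ∃ T : SubcubicTree ι, ∀ d, P (T.side d) ∨ P (T.side d)ᶜ := by
  have hdeg : ∀ v, ((parentGraph par).neighborSet v).ncard = 1 ↔ v ∈ Set.range l := by
    intro v
    rw [hT.neighborSet_ncard, hl']
    by_cases hv : v = r
    · subst hv
      simp [hr, hT.par_root]
    · rw [hT.parent_ncard v hv]
      simp [hv]
  let T : SubcubicTree ι :=
    { numVertices := m
      graph := parentGraph par
      isTree := hT.isTree
      degree_eq := by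
        intro v
        rw [hT.neighborSet_ncard]
        by_cases hv : v = r
        · subst hv
          simp [hr, hT.par_root]
        · rw [hT.parent_ncard v hv]
          rcases hc v hv with h | h <;> simp [h]
      leaf := Equiv.ofBijective (fun i => ⟨l i, (hdeg _).2 ⟨i, rfl⟩⟩) (by
        constructor
        · intro i j hij
          exact hl (congrArg Subtype.val hij)
        · rintro ⟨v, hv⟩
          obtain ⟨i, rfl⟩ := (hdeg v).1 hv
          exact ⟨i, rfl⟩) }
  -- Only edges oriented towards the root have descendants as their side; the opposite orientation
  -- gives the complement, hence the disjunction in the conclusion.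
  have hdown : ∀ v w (hadj : T.graph.Adj v w), par v = some w → P (T.side ⟨(v, w), hadj⟩) := by
    intro v w hadj hvw
    have hv : v ≠ r := fun h0 => by rw [h0, hT.par_root] at hvw; cases hvw
    obtain ⟨A, hA, hAi⟩ := hP v hv
    have : T.side ⟨(v, w), hadj⟩ = A := by
      ext i
      rw [T.mem_side, hAi]
      change l i ∈ edgeComponent (parentGraph par) v w ↔ _
      rw [hT.edgeComponent_eq hvw]
      rfl
    rwa [this]
  refine ⟨T, fun d => ?_⟩
  obtain ⟨⟨v, w⟩, hadj⟩ := d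
  rcases (hT.adj_iff v w).1 hadj with hp | hp
  · exact Or.inl (hdown v w hadj hp)
  · right
    rw [← T.side_symm]
    exact hdown w v hadj.symm hp

theorem IsRootedTree.exists_subcubicTree {ι : Type} [Fintype ι] [DecidableEq ι] [Fintype W]
    (hT : IsRootedTree par h r)
    (hr : {u | par u = some r}.ncard = 1)
    (hc : ∀ v ≠ r, {u | par u = some v}.ncard = 0 ∨ {u | par u = some v}.ncard = 2)
    (l : ι → W) (hl : Function.Injective l)
    (hl' : ∀ v, v ∈ Set.range l ↔ v = r ∨ {u | par u = some v}.ncard = 0) {P : Finset ι → Prop}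
    (hP : ∀ v ≠ r, ∃ A, P A ∧ ∀ i, i ∈ A ↔ Below par (l i) v) :
    ∃ T : SubcubicTree ι, ∀ d, P (T.side d) ∨ P (T.side d)ᶜ := by
  set e := Fintype.equivFin W
  have hch : ∀ v, {u | (par (e.symm u)).map e = some v}.ncard =
      {u | par u = some (e.symm v)}.ncard := by
    intro v
    rw [← Set.ncard_image_of_injective _ e.injective]
    congr 1
    ext u
    rw [e.image_eq_preimage_symm]
    simp only [Set.mem_ofPred_eq, Set.mem_preimage, Option.map_eq_some_iff]
    constructor
    · rintro ⟨a, ha, rfl⟩; simpa using ha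
    · intro hu; exact ⟨_, hu, by simp⟩
  refine (hT.transport e).exists_subcubicTree_fin (by rw [hch]; simpa using hr)
    (fun v hv => ?_) (e ∘ l) (e.injective.comp hl) (fun v => ?_) (fun v hv => ?_)
  · rw [hch]; exact hc _ fun h => hv (by rw [← h]; simp)
  · rw [hch, Set.range_comp, e.image_eq_preimage_symm, Set.mem_preimage, hl',
      Equiv.symm_apply_eq]
  · obtain ⟨A, hA, hAi⟩ := hP (e.symm v) fun h => hv (by rw [← h]; simp)
    refine ⟨A, hA, fun i => ?_⟩
    rw [hAi, ← below_transport_iff par e]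
    simp

end ParentFunctions

/-! ### From hierarchical decompositions back to subcubic trees. -/

section Planting

/-- The parent function of a forest after its roots have been made children of a new vertex. -/
def addRoot {V : Type*} (par : V → Option V) : Option V → Option (Option V) :=
  Option.map par

theorem addRoot_some {V : Type*} (par : V → Option V) (v : V) :
    addRoot par (some v) = some (par v) := rfl

/-- The value `none` of `par`, which marks an old root, is reused as the name of the new vertex in
`Option V`. -/
theorem addRoot_eq_some_iff {V : Type*} (par : V → Option V) (u : Option V) (w : Option V) :
    addRoot par u = some w ↔ ∃ v, u = some v ∧ par v = w := by
  cases u <;> simp [addRoot]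

theorem isRootedTree_addRoot {V : Type*} {par : V → Option V} {h : V → ℕ}
    (hh : ∀ v w, par v = some w → h w < h v) (hr : ∀ v, ∃ r, Below par v r ∧ par r = none) :
    IsRootedTree (addRoot par) (fun x => x.elim 0 fun v => h v + 1) none := by
  refine ⟨rfl, fun v => ?_, fun v w hvw => ?_⟩
  · rcases v with _ | v
    · exact Relation.ReflTransGen.refl
    · obtain ⟨r, hvr, hr⟩ := hr v
      refine Relation.ReflTransGen.tail (b := some r) ?_ (by rw [addRoot_some, hr])
      exact hvr.map some fun a b hab => by rw [addRoot_some, hab]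
  · obtain ⟨v, rfl, rfl⟩ := (addRoot_eq_some_iff _ _ _).1 hvw
    rcases hp : par v with _ | w
    · simp
    · simpa using hh _ _ hp

theorem below_addRoot_iff {V : Type*} (par : V → Option V) (u v : V) :
    Below (addRoot par) (some u) (some v) ↔ Below par u v := by
  constructor
  · intro hb
    have key : ∀ y, Below (addRoot par) (some u) y → ∀ v, y = some v → Below par u v := by
      intro y hy
      induction hy with
      | refl => rintro v hv; cases hv; exact Relation.ReflTransGen.refl
      | tail _ hbc ih =>
        rintro v rfl
        obtain ⟨w, rfl, hw⟩ := (addRoot_eq_some_iff _ _ _).1 hbc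
        exact Relation.ReflTransGen.tail (ih w rfl) hw
    exact key _ hb v rfl
  · exact fun hb => hb.map some fun a b hab => by rw [addRoot_some, hab]

theorem ncard_children_addRoot {V : Type*} (par : V → Option V) (w : Option V) :
    {u | addRoot par u = some w}.ncard = {v | par v = w}.ncard := by
  rw [← Set.ncard_image_of_injective _ (Option.some_injective V)]
  congr 1
  ext u
  simp only [Set.mem_ofPred_eq, Set.mem_image, addRoot_eq_some_iff]
  constructor
  · rintro ⟨v, rfl, hv⟩; exact ⟨v, hv, rfl⟩
  · rintro ⟨v, hv, rfl⟩; exact ⟨v, rfl, hv⟩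

variable {V : Bool → Type}

/-- The disjoint union of two parent functions. -/
def sigmaPar (par : ∀ b, V b → Option (V b)) : (Σ b, V b) → Option (Σ b, V b) :=
  fun x => (par x.1 x.2).map (Sigma.mk x.1)

theorem sigmaPar_eq_some_iff (par : ∀ b, V b → Option (V b)) (x y : Σ b, V b) :
    sigmaPar par x = some y ↔ ∃ b v w, x = ⟨b, v⟩ ∧ y = ⟨b, w⟩ ∧ par b v = some w := by
  obtain ⟨b, v⟩ := x
  constructor
  · intro h
    obtain ⟨w, hw, rfl⟩ := Option.map_eq_some_iff.1 h
    exact ⟨b, v, w, rfl, rfl, hw⟩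
  · rintro ⟨b', v', w, hx, rfl, hw⟩
    cases hx
    simp [sigmaPar, hw]

theorem below_sigmaPar {par : ∀ b, V b → Option (V b)} {x y : Σ b, V b}
    (h : Below (sigmaPar par) x y) : ∃ b v w, x = ⟨b, v⟩ ∧ y = ⟨b, w⟩ ∧ Below (par b) v w := by
  induction h with
  | refl => exact ⟨x.1, x.2, x.2, rfl, rfl, Relation.ReflTransGen.refl⟩
  | tail _ hbc ih =>
    obtain ⟨b, v, w, rfl, rfl, hvw⟩ := ih
    obtain ⟨b', v', w', he, rfl, hvw'⟩ := (sigmaPar_eq_some_iff _ _ _).1 hbc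
    cases he
    exact ⟨b, v, w', rfl, rfl, Relation.ReflTransGen.tail hvw hvw'⟩

theorem below_sigmaPar_mk {par : ∀ b, V b → Option (V b)} {b : Bool} {v w : V b}
    (h : Below (par b) v w) : Below (sigmaPar par) ⟨b, v⟩ ⟨b, w⟩ :=
  h.map (Sigma.mk b) fun a c hac => (sigmaPar_eq_some_iff _ _ _).2 ⟨b, a, c, rfl, rfl, hac⟩

theorem ncard_children_sigmaPar (par : ∀ b, V b → Option (V b)) (b : Bool) (w : V b) :
    {x | sigmaPar par x = some ⟨b, w⟩}.ncard = {v | par b v = some w}.ncard := by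
  rw [← Set.ncard_image_of_injective {v | par b v = some w}
    (sigma_mk_injective (i := b) : Function.Injective (Sigma.mk b))]
  congr 1
  ext x
  simp only [Set.mem_ofPred_eq, Set.mem_image, sigmaPar_eq_some_iff]
  constructor
  · rintro ⟨b', v, w', rfl, he, hv⟩
    cases he
    exact ⟨v, hv, rfl⟩
  · rintro ⟨v, hv, rfl⟩; exact ⟨b, v, w, rfl, rfl, hv⟩

theorem ncard_roots_sigmaPar {par : ∀ b, V b → Option (V b)} {r : ∀ b, V b}
    (hr : ∀ b v, par b v = none ↔ v = r b) : {x | sigmaPar par x = none}.ncard = 2 := by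
  have : {x | sigmaPar par x = none} = {⟨true, r true⟩, ⟨false, r false⟩} := by
    ext ⟨b, v⟩
    simp only [Set.mem_ofPred_eq, sigmaPar, Option.map_eq_none_iff, hr, Set.mem_insert_iff,
      Set.mem_singleton_iff]
    cases b <;> simp
  rw [this, Set.ncard_pair]
  intro h
  exact absurd (congrArg Sigma.fst h) (by simp)

/-- A leaf gives a single vertex; a node gives a new root above the disjoint union of the two
subtrees. The labelling `l` is total on `ι` but meaningful only on `S`. -/
theorem BranchDecomp.exists_rootedTree {ι : Type} [DecidableEq ι] {P : Finset ι → Prop}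
    {S : Finset ι} (hS : BranchDecomp P S) :
    ∃ (V : Type) (_ : Fintype V) (par : V → Option V) (h : V → ℕ) (r : V) (l : ι → V),
      IsRootedTree par h r ∧
      (∀ v, {u | par u = some v}.ncard = 0 ∨ {u | par u = some v}.ncard = 2) ∧
      Set.InjOn l S ∧ (∀ v, v ∈ l '' S ↔ {u | par u = some v}.ncard = 0) ∧
      ∀ v, ∃ A ⊆ S, P A ∧ ∀ i ∈ S, i ∈ A ↔ Below par (l i) v := by
  induction hS with
  | leaf i hi =>
    refine ⟨Unit, inferInstance, fun _ => none, fun _ => 0, (), fun _ => (), ⟨rfl, ?_, ?_⟩, ?_, ?_,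
      ?_, ?_⟩
    · intro v; exact Relation.ReflTransGen.refl
    · intro v w h; cases h
    · intro v; simp
    · simp
    · intro v; simp
    · intro v
      refine ⟨{i}, subset_rfl, hi, fun j hj => ?_⟩
      exact iff_of_true hj Relation.ReflTransGen.refl
  | @node A B hAB _ _ hun ihA ihB =>
    -- Both subtrees are treated at once, with `true` standing for `A`; deciding `i ∈ A` then tells
    -- which subtree carries the label `i`.
    have ih : ∀ b : Bool, ∃ (V : Type) (_ : Fintype V) (par : V → Option V) (h : V → ℕ) (r : V)
        (l : ι → V), IsRootedTree par h r ∧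
        (∀ v, {u | par u = some v}.ncard = 0 ∨ {u | par u = some v}.ncard = 2) ∧
        Set.InjOn l (cond b A B : Finset ι) ∧
        (∀ v, v ∈ l '' (cond b A B : Finset ι) ↔ {u | par u = some v}.ncard = 0) ∧
        ∀ v, ∃ C ⊆ cond b A B, P C ∧ ∀ i ∈ cond b A B, i ∈ C ↔ Below par (l i) v := by
      rintro (_ | _)
      · exact ihB
      · exact ihA
    clear ihA ihB
    choose V hV par h r l hT hc hl hl' hP using ih
    have hcov : ∀ i, i ∈ A ∪ B → i ∈ cond (decide (i ∈ A)) A B := by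
      intro i hi
      by_cases hA : i ∈ A
      · simp [hA]
      · simpa [hA] using hi
    have hdec : ∀ b, ∀ i ∈ cond b A B, decide (i ∈ A) = b := by
      rintro (_ | _) i hi
      · simpa using Finset.disjoint_right.1 hAB hi
      · simpa using hi
    have hsub : ∀ b, cond b A B ⊆ A ∪ B := by
      rintro (_ | _)
      · exact Finset.subset_union_right
      · exact Finset.subset_union_left
    have hlb : ∀ b, ∀ i ∈ cond b A B,
        (⟨decide (i ∈ A), l _ i⟩ : Σ b, V b) = ⟨b, l b i⟩ := by
      intro b i hi
      obtain rfl := hdec b i hi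
      rfl
    have hroot : ∀ x, ∃ y, Below (sigmaPar par) x y ∧ sigmaPar par y = none := by
      rintro ⟨b, v⟩
      exact ⟨⟨b, r b⟩, below_sigmaPar_mk ((hT b).below_root v), by simp [sigmaPar, (hT b).par_root]⟩
    have hheight : ∀ x y, sigmaPar par x = some y → h y.1 y.2 < h x.1 x.2 := by
      intro x y hxy
      obtain ⟨b, v, w, rfl, rfl, hvw⟩ := (sigmaPar_eq_some_iff _ _ _).1 hxy
      exact (hT b).height _ _ hvw
    have hrt := isRootedTree_addRoot (h := fun x : Σ b, V b => h x.1 x.2) hheight hroot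
    refine ⟨Option (Σ b, V b), inferInstance, addRoot (sigmaPar par), _, none,
      fun i => some ⟨decide (i ∈ A), l _ i⟩, hrt, ?_, ?_, ?_, ?_⟩
    · rintro (_ | ⟨b, v⟩)
      · rw [ncard_children_addRoot, ncard_roots_sigmaPar fun b => (hT b).par_eq_none_iff]
        exact Or.inr rfl
      · rw [ncard_children_addRoot, ncard_children_sigmaPar]
        exact hc b v
    · intro i hi j hj hij
      have hi' := hcov i hi
      have hj' := hcov j hj
      rw [Option.some_inj] at hij
      have hb := congrArg Sigma.fst hij
      simp only at hb
      rw [← hb] at hj'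
      rw [hlb _ j hj'] at hij
      exact hl _ hi' hj' (sigma_mk_injective hij)
    · rintro (_ | ⟨b, v⟩)
      · rw [ncard_children_addRoot, ncard_roots_sigmaPar fun b => (hT b).par_eq_none_iff]
        simp
      · rw [ncard_children_addRoot, ncard_children_sigmaPar, ← hl' b v]
        constructor
        · rintro ⟨i, hi, he⟩
          rw [Option.some_inj] at he
          have hb := congrArg Sigma.fst he
          simp only at hb
          subst hb
          exact ⟨i, hcov i hi, sigma_mk_injective he⟩
        · rintro ⟨i, hi, rfl⟩
          exact ⟨i, hsub b hi, congrArg some (hlb b i hi)⟩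
    · rintro (_ | ⟨b, v⟩)
      · exact ⟨_, subset_rfl, hun, fun i hi => iff_of_true hi (hrt.below_root _)⟩
      · obtain ⟨C, hCS, hPC, hC⟩ := hP b v
        refine ⟨C, hCS.trans (hsub b), hPC, fun i hi => ?_⟩
        rw [below_addRoot_iff]
        constructor
        · intro hiC
          rw [hlb b i (hCS hiC)]
          exact below_sigmaPar_mk ((hC i (hCS hiC)).1 hiC)
        · intro hb
          obtain ⟨b', u, w, hu, hw, huw⟩ := below_sigmaPar hb
          cases hw
          have hb' := congrArg Sigma.fst hu
          simp only at hb'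
          subst hb'
          rw [← sigma_mk_injective hu] at huw
          exact (hC i (hcov i hi)).2 huw

/-- A decomposition of all leaves but one comes from a subcubic tree. -/
theorem BranchDecomp.exists_subcubicTree {ι : Type} [Fintype ι] [DecidableEq ι]
    {P : Finset ι → Prop} {i₀ : ι} (hS : BranchDecomp P (Finset.univ.erase i₀)) :
    ∃ T : SubcubicTree ι, ∀ d, P (T.side d) ∨ P (T.side d)ᶜ := by
  obtain ⟨V, hV, par, h, r, l, hT, hc, hl, hl', hP⟩ := hS.exists_rootedTree
  -- The new vertex above the old root is the leaf labelled `i₀`; it gives the old root its missing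
  -- edge.
  have hrt := isRootedTree_addRoot (h := h) hT.height fun v => ⟨r, hT.below_root v, hT.par_root⟩
  have hmem : ∀ i, i ≠ i₀ → i ∈ Finset.univ.erase i₀ := fun i hi => by simpa using hi
  refine hrt.exists_subcubicTree ?_ ?_ (fun i => if i = i₀ then none else some (l i)) ?_ ?_ ?_
  · rw [ncard_children_addRoot]
    simp [hT.par_eq_none_iff]
  · rintro (_ | v) hv
    · exact (hv rfl).elim
    · rw [ncard_children_addRoot]; exact hc v
  · intro i j hij
    by_cases hi : i = i₀ <;> by_cases hj : j = i₀ <;> simp [hi, hj] at hij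
    · rw [hi, hj]
    · exact hl (hmem i hi) (hmem j hj) hij
  · rintro (_ | v)
    · simp only [true_or, iff_true]
      exact ⟨i₀, by simp⟩
    · rw [ncard_children_addRoot, ← hl']
      simp only [Set.mem_range, Set.mem_image, reduceCtorEq, false_or]
      constructor
      · rintro ⟨i, hi⟩
        by_cases h0 : i = i₀
        · simp [h0] at hi
        · refine ⟨i, hmem i h0, ?_⟩
          simpa [h0] using hi
      · rintro ⟨i, hi, rfl⟩
        refine ⟨i, if_neg (by simpa using hi)⟩
  · rintro (_ | v) hv
    · exact (hv rfl).elim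
    · obtain ⟨C, hCS, hPC, hC⟩ := hP v
      refine ⟨C, hPC, fun i => ?_⟩
      by_cases h0 : i = i₀
      · subst h0
        refine iff_of_false (fun hi => by simpa using hCS hi) fun hb => ?_
        rw [if_pos rfl] at hb
        rcases Relation.ReflTransGen.cases_head hb with hh | ⟨c, hc, _⟩
        · cases hh
        · cases hc
      · rw [if_neg h0, below_addRoot_iff]
        exact hC i (hmem i h0)

end Planting

/-! ### Comparison of widths. -/

section Widths

/-- No vertex is isolated, so a supremum over the edges is never the default value of an empty one.
-/
theorem SubcubicTree.nonempty_dart {ι : Type} (T : SubcubicTree ι) : Nonempty T.graph.Dart := by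
  obtain ⟨v⟩ := T.isTree.connected.nonempty
  have : (T.graph.neighborSet v).Nonempty := by
    rw [← Set.ncard_pos]
    rcases T.degree_eq v with h | h <;> omega
  obtain ⟨w, hw⟩ := this
  exact ⟨⟨(v, w), hw⟩⟩

theorem SubcubicTree.le_iSup_side {ι : Type} [Fintype ι] (T : SubcubicTree ι)
    {α : Type} [ConditionallyCompleteLattice α] (f : Finset ι → α) (d : T.graph.Dart) :
    f (T.side d) ≤ ⨆ d, f (T.side d) :=
  le_ciSup (f := fun d => f (T.side d))
    ((Set.finite_range f).subset (Set.range_comp_subset_range T.side f) |>.bddAbove) d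

theorem nonempty_subcubicTree {n : ℕ} (hn : 2 ≤ n) : Nonempty (SubcubicTree (Fin n)) := by
  have h : (Finset.univ.erase (⟨0, by omega⟩ : Fin n)).Nonempty :=
    ⟨⟨1, by omega⟩, by simp⟩
  obtain ⟨T, -⟩ := (BranchDecomp.of_forall (P := fun _ => True) (fun _ => trivial)
    h).exists_subcubicTree
  exact ⟨T⟩

theorem treeMinMax_le {ι : Type} [Fintype ι] {α : Type} [ConditionallyCompleteLattice α]
    {f : Finset ι → α} (hb : BddBelow (Set.range f)) (T : SubcubicTree ι) :
    treeMinMax f ≤ ⨆ d, f (T.side d) := by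
  refine ciInf_le ?_ T
  obtain ⟨b, hb⟩ := hb
  refine ⟨b, ?_⟩
  rintro _ ⟨T, rfl⟩
  obtain ⟨d⟩ := T.nonempty_dart
  exact (hb ⟨_, rfl⟩).trans (T.le_iSup_side f d)

/-- A width does not increase if the cut function decreases under restriction of the leaves. -/
theorem treeMinMax_le_treeMinMax {N n : ℕ} (hn : 2 ≤ n) (e : Fin n ↪ Fin N)
    {g : Finset (Fin n) → ℝ} {f : Finset (Fin N) → ℝ} (hgf : ∀ A, g (pullback e A) ≤ f A) :
    treeMinMax g ≤ treeMinMax f := by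
  have hN : 2 ≤ N := hn.trans (by simpa using Fintype.card_le_of_embedding e)
  have := nonempty_subcubicTree hN
  refine le_ciInf fun T => ?_
  -- Rooting the large tree at the image of a small leaf makes "all leaves but the root" restrict to
  -- "all leaves but `j₀`", the form that planting requires.
  set j₀ : Fin n := ⟨0, by omega⟩
  have hp : pullback e (Finset.univ.erase (e j₀)) = Finset.univ.erase j₀ := by
    ext j; simp [mem_pullback]
  have hd := (T.branchDecomp (e j₀)).pullback e (by
    rw [hp]; exact ⟨⟨1, by omega⟩, by simp [j₀]⟩)
  rw [hp] at hd
  obtain ⟨T', hT'⟩ := hd.exists_subcubicTree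
  refine (treeMinMax_le (Set.finite_range g).bddBelow T').trans ?_
  have := T'.nonempty_dart
  refine ciSup_le fun d => ?_
  -- Sides of `T'` are known only up to complement; reversing the dart of `T` compensates.
  have : ∃ d', T'.side d = pullback e (T.side d') := by
    rcases hT' d with ⟨_, ⟨d', rfl⟩, hd'⟩ | ⟨_, ⟨d', rfl⟩, hd'⟩
    · exact ⟨d', hd'⟩
    · refine ⟨d'.symm, ?_⟩
      rw [← compl_compl (T'.side d), hd', T.side_symm]
      ext j; simp [mem_pullback]
  obtain ⟨d', hd'⟩ := this
  rw [hd']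
  exact (hgf _).trans (T.le_iSup_side f d')

/-- A cut function that is large on balanced cuts has large width. -/
theorem le_treeMinMax {n a : ℕ} (hn : 2 ≤ n) (hna : 3 * a + 1 ≤ n) {f : Finset (Fin n) → ℝ} {c : ℝ}
    (hf : ∀ A : Finset (Fin n), a ≤ A.card → a ≤ Aᶜ.card → c ≤ f A) : c ≤ treeMinMax f := by
  have := nonempty_subcubicTree hn
  refine le_ciInf fun T => ?_
  obtain ⟨_, ⟨d, rfl⟩, hd, hd'⟩ := (T.branchDecomp ⟨0, by omega⟩).exists_balanced (a := a) (by
    rw [Finset.card_erase_of_mem (Finset.mem_univ _), Finset.card_univ, Fintype.card_fin]; omega)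
  refine (hf _ hd ?_).trans (T.le_iSup_side f d)
  -- At least `3 * a + 1` leaves, of which the cluster takes at most `2 * a + 1`, leave `a` outside.
  rw [Finset.card_compl, Fintype.card_fin]; omega

theorem entropicWidth_le_of_LOCCGe {N n : ℕ} (hn : 2 ≤ n) {ψ : QubitState N} {φ : QubitState n}
    (h : LOCCGe ψ φ) : entropicWidth φ ≤ entropicWidth ψ := by
  obtain ⟨f, hf⟩ := h
  exact treeMinMax_le_treeMinMax hn f (entanglementEntropy_pullback_le hf)

theorem schmidtRank_pos {n : ℕ} (ψ : QubitState n) (A : Finset (Fin n)) :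
    0 < schmidtRank ψ.amp A := by
  rw [Nat.pos_iff_ne_zero, schmidtRank]
  intro h
  have h0 := trace_reducedDensity ψ.amp A
  have hH := reducedDensity_isHermitian ψ.amp A
  rw [hH.rank_eq_card_non_zero_eigs, Fintype.card_eq_zero_iff, isEmpty_subtype] at h
  simp only [not_not] at h
  rw [hH.trace_eq_sum_eigenvalues, ψ.normalized] at h0
  simp [h] at h0

theorem schmidtRankWidth_le_of_LOCCGe {N n : ℕ} (hn : 2 ≤ n) {ψ : QubitState N} {φ : QubitState n}
    (h : LOCCGe ψ φ) : schmidtRankWidth φ ≤ schmidtRankWidth ψ := by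
  obtain ⟨f, hf⟩ := h
  refine treeMinMax_le_treeMinMax hn f fun A => ?_
  exact Real.logb_le_logb_of_le one_lt_two (by exact_mod_cast schmidtRank_pos _ _)
    (by exact_mod_cast schmidtRank_pullback_le hf A)

theorem entropicWidth_le_schmidtRankWidth {n : ℕ} (ψ : QubitState n) :
    entropicWidth ψ ≤ schmidtRankWidth ψ := by
  rcases isEmpty_or_nonempty (SubcubicTree (Fin n)) with h | h
  · rw [entropicWidth, schmidtRankWidth, treeMinMax, treeMinMax, Real.iInf_of_isEmpty,
      Real.iInf_of_isEmpty]
  · refine le_ciInf fun T => ?_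
    refine (treeMinMax_le (Set.finite_range _).bddBelow T).trans ?_
    have := T.nonempty_dart
    exact ciSup_le fun d => (entanglementEntropy_le_logb_schmidtRank ψ _).trans
      (T.le_iSup_side (fun A => Real.logb 2 (schmidtRank ψ.amp A)) d)

end Widths

/-! ### States of large width from Hamming weights modulo `r`. -/

section ModularState

set_option linter.unusedSectionVars false

open Finset

variable {r : ℕ} [NeZero r] {σ : Type*} [Fintype σ] [DecidableEq σ]

/-- The Hamming weight modulo `r`. -/
def weightMod (r : ℕ) (x : σ → Fin 2) : ZMod r := ∑ i, ((x i : ℕ) : ZMod r)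

/-- The number of bit strings of given Hamming weight modulo `r`. -/
def weightCount (σ : Type*) [Fintype σ] [DecidableEq σ] (c : ZMod r) : ℕ :=
  (univ.filter fun x : σ → Fin 2 => weightMod r x = c).card

/-- A character turns the sum of the bits into a product, so the sum over strings factors into `1 +
ψ 1` for each bit. -/
theorem addChar_weightMod (ψ : AddChar (ZMod r) ℂ) :
    ∑ x : σ → Fin 2, ψ (weightMod r x) = (1 + ψ 1) ^ Fintype.card σ := by
  have h : ∀ x : σ → Fin 2, ψ (weightMod r x) = ∏ i, ψ ((x i : ℕ) : ZMod r) := by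
    intro x
    rw [weightMod]
    induction (univ : Finset σ) using Finset.induction_on with
    | empty => simp
    | insert a s ha ih => rw [Finset.sum_insert ha, Finset.prod_insert ha,
        AddChar.map_add_eq_mul, ih]
  simp_rw [h]
  have := Finset.prod_univ_sum (fun _ : σ => (univ : Finset (Fin 2)))
    (fun _ b => ψ ((b : ℕ) : ZMod r))
  rw [Fintype.piFinset_univ] at this
  rw [← this, Finset.prod_const, Finset.card_univ, Fin.sum_univ_two]
  simp

/-- Fourier inversion on `ZMod r`: orthogonality of characters singles out the weight `c`. -/
theorem card_mul_weightCount (c : ZMod r) :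
    (r : ℂ) * weightCount σ c = ∑ ψ : AddChar (ZMod r) ℂ, ψ (-c) * (1 + ψ 1) ^ Fintype.card σ := by
  simp_rw [← addChar_weightMod (σ := σ), Finset.mul_sum, ← AddChar.map_add_eq_mul]
  rw [Finset.sum_comm]
  simp_rw [AddChar.sum_apply_eq_ite, neg_add_eq_zero, weightCount]
  rw [← Finset.sum_filter, Finset.sum_const, ZMod.card, nsmul_eq_mul, mul_comm]
  simp_rw [eq_comm]

/-- As `1` generates `ZMod r`, a nontrivial character has `ψ 1 ≠ 1`; on the unit circle `‖1 + z‖ =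
2` only at `z = 1`. -/
theorem norm_one_add_lt_two (ψ : AddChar (ZMod r) ℂ) (hψ : ψ ≠ 0) : ‖(1 + ψ 1) / 2‖ < 1 := by
  have h1 : ψ 1 ≠ 1 := by
    intro h
    refine hψ (DFunLike.ext _ _ fun k => ?_)
    obtain ⟨m, rfl⟩ := ZMod.natCast_zmod_surjective k
    have := AddChar.map_nsmul_eq_pow ψ m (1 : ZMod r)
    rw [nsmul_one, h, one_pow] at this
    rw [this, AddChar.zero_apply]
  have hn : ‖ψ 1‖ = 1 := ψ.norm_apply 1
  set z := ψ 1 with hz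
  have hsq : z.re ^ 2 + z.im ^ 2 = 1 := by
    have := Complex.sq_norm z
    rw [hn, Complex.normSq_apply] at this
    nlinarith
  have hre : z.re < 1 := by
    by_contra! hge
    have h3 : z.im = 0 := by nlinarith [sq_nonneg z.im]
    have h2 : z.re = 1 := by nlinarith [sq_nonneg z.im]
    exact h1 (Complex.ext (by simp [h2]) (by simp [h3]))
  have : ‖1 + z‖ ^ 2 < 2 ^ 2 := by
    rw [Complex.sq_norm, Complex.normSq_apply]
    simp only [Complex.add_re, Complex.one_re, Complex.add_im, Complex.one_im]
    nlinarith
  have h2 : ‖1 + z‖ < 2 := lt_of_pow_lt_pow_left₀ 2 zero_le_two this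
  rw [norm_div]
  simpa [div_lt_one] using h2

/-- Hamming weights modulo `r` are equidistributed up to a factor, on sufficiently many bits. -/
theorem weightCount_bounds (r : ℕ) [NeZero r] : ∃ a₀ : ℕ, ∀ (σ : Type) [Fintype σ] [DecidableEq σ],
    a₀ ≤ Fintype.card σ → ∀ c : ZMod r,
      2 ^ Fintype.card σ ≤ 2 * ((r : ℝ) * weightCount σ c) ∧
      (r : ℝ) * weightCount σ c ≤ 2 * 2 ^ Fintype.card σ := by
  have hlim : Filter.Tendsto (fun a : ℕ => ∑ ψ ∈ (univ : Finset (AddChar (ZMod r) ℂ)).erase 0,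
      ‖(1 + ψ 1) / 2‖ ^ a) Filter.atTop (nhds 0) := by
    rw [show (0 : ℝ) = ∑ ψ ∈ (univ : Finset (AddChar (ZMod r) ℂ)).erase 0, (0 : ℝ) by simp]
    refine tendsto_finsetSum _ fun ψ hψ => ?_
    exact tendsto_pow_atTop_nhds_zero_of_lt_one (norm_nonneg _)
      (norm_one_add_lt_two ψ (Finset.ne_of_mem_erase hψ))
  obtain ⟨a₀, ha₀⟩ := Filter.eventually_atTop.1 (hlim.eventually (gt_mem_nhds one_half_pos))
  refine ⟨a₀, fun σ _ _ hσ c => ?_⟩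
  have h := ha₀ _ hσ
  have hpos : (0 : ℝ) < 2 ^ Fintype.card σ := by positivity
  -- The trivial character contributes exactly `2 ^ card σ`; relative to it, all others together
  -- contribute less than `1 / 2`.
  have key : ‖((r : ℂ) * weightCount σ c) / 2 ^ Fintype.card σ - 1‖ < 1 / 2 := by
    refine lt_of_le_of_lt ?_ h
    have e : ((r : ℂ) * weightCount σ c) / 2 ^ Fintype.card σ - 1 =
        ∑ ψ ∈ (univ : Finset (AddChar (ZMod r) ℂ)).erase 0,
          ψ (-c) * ((1 + ψ 1) / 2) ^ Fintype.card σ := by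
      rw [card_mul_weightCount, ← Finset.add_sum_erase _ _ (Finset.mem_univ 0),
        AddChar.zero_apply, AddChar.zero_apply, add_div, one_mul, one_add_one_eq_two,
        div_self (pow_ne_zero _ two_ne_zero), add_sub_cancel_left, Finset.sum_div]
      refine Finset.sum_congr rfl fun ψ _ => ?_
      rw [div_pow, mul_div_assoc]
    rw [e]
    refine (norm_sum_le _ _).trans (Finset.sum_le_sum fun ψ _ => ?_)
    rw [norm_mul, ψ.norm_apply, one_mul, norm_pow]
  have e2 : ((r : ℂ) * weightCount σ c) / 2 ^ Fintype.card σ - 1 =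
      (((r : ℝ) * weightCount σ c / 2 ^ Fintype.card σ - 1 : ℝ) : ℂ) := by push_cast; rfl
  rw [e2, Complex.norm_real, Real.norm_eq_abs, abs_lt] at key
  constructor
  · have : 1 / 2 ≤ (r : ℝ) * weightCount σ c / 2 ^ Fintype.card σ := by linarith
    rw [le_div_iff₀ hpos] at this; linarith
  · have : (r : ℝ) * weightCount σ c / 2 ^ Fintype.card σ ≤ 2 := by linarith
    rw [div_le_iff₀ hpos] at this; linarith

theorem weightCount_zero_pos (σ : Type*) [Fintype σ] [DecidableEq σ] :
    0 < weightCount σ (0 : ZMod r) :=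
  Finset.card_pos.2 ⟨fun _ => 0, by
    rw [Finset.mem_filter]
    exact ⟨Finset.mem_univ _, Finset.sum_eq_zero fun i _ => by simp⟩⟩

theorem weightMod_glue {n : ℕ} (A : Finset (Fin n)) (x : {i // i ∈ A} → Fin 2)
    (z : {i // i ∉ A} → Fin 2) :
    weightMod r (glue A x z) = weightMod r x + weightMod r z := by
  rw [weightMod, ← Fintype.sum_subtype_add_sum_subtype (fun i => i ∈ A)]
  congr 1
  · exact Finset.sum_congr (by ext; simp) fun i _ => by rw [glue_of_mem A _ _ i.2]
  · exact Finset.sum_congr (by ext; simp) fun i _ => by rw [glue_of_notMem A _ _ i.2]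

/-- The uniform superposition of the bit strings of Hamming weight divisible by `r`. -/
noncomputable def modularState (r : ℕ) [NeZero r] (n : ℕ) : QubitState n where
  amp x := if weightMod r x = 0 then
    (((Real.sqrt (weightCount (Fin n) (0 : ZMod r)))⁻¹ : ℝ) : ℂ) else 0
  normalized := by
    have hpos : (0 : ℝ) < weightCount (Fin n) (0 : ZMod r) := by
      exact_mod_cast weightCount_zero_pos (r := r) (Fin n)
    simp only [apply_ite, norm_zero, Complex.norm_real, Real.norm_eq_abs, ite_pow, sq_abs, inv_pow,
      Real.sq_sqrt hpos.le]
    simp only [ne_eq, OfNat.ofNat_ne_zero, not_false_eq_true, zero_pow]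
    rw [← Finset.sum_filter, Finset.sum_const, nsmul_eq_mul]
    exact mul_inv_cancel₀ hpos.ne'

theorem norm_modularState (n : ℕ) (x : Fin n → Fin 2) : ‖(modularState r n).amp x‖ =
    if weightMod r x = 0 then (Real.sqrt (weightCount (Fin n) (0 : ZMod r)))⁻¹ else 0 := by
  have h : (modularState r n).amp x = if weightMod r x = 0 then
    (((Real.sqrt (weightCount (Fin n) (0 : ZMod r)))⁻¹ : ℝ) : ℂ) else 0 := rfl
  rw [h]
  split_ifs
  · rw [Complex.norm_real, Real.norm_of_nonneg (by positivity)]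
  · exact norm_zero

/-- All nonzero amplitudes equal `s`, so a row sum is bounded by counting strings on both sides.
Each of the two counts is at most twice its mean and the normalisation `W` at least half of its
mean, whence `8 = 2 * 2 * 2`. -/
theorem sum_row_reducedDensity_modularState_le {n a₀ : ℕ}
    (ha₀ : ∀ (σ : Type) [Fintype σ] [DecidableEq σ], a₀ ≤ Fintype.card σ → ∀ c : ZMod r,
      2 ^ Fintype.card σ ≤ 2 * ((r : ℝ) * weightCount σ c) ∧
      (r : ℝ) * weightCount σ c ≤ 2 * 2 ^ Fintype.card σ)
    {A : Finset (Fin n)} (hA : a₀ ≤ A.card) (hA' : a₀ ≤ Aᶜ.card) (x : {i // i ∈ A} → Fin 2) :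
    ∑ y, ‖reducedDensity (modularState r n).amp A x y‖ ≤ 8 / r := by
  set W := weightCount (Fin n) (0 : ZMod r) with hW
  set s := (Real.sqrt W)⁻¹ with hs
  have hWpos : (0 : ℝ) < W := by exact_mod_cast weightCount_zero_pos (r := r) (Fin n)
  have hr : (0 : ℝ) < r := by exact_mod_cast Nat.pos_of_ne_zero (NeZero.ne r)
  have hs0 : 0 ≤ s := by positivity
  have hs2 : s * s = (W : ℝ)⁻¹ := by
    rw [hs, ← mul_inv, Real.mul_self_sqrt hWpos.le]
  have hcA : Fintype.card {i // i ∈ A} = A.card := Fintype.card_coe A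
  have hcA' : Fintype.card {i // i ∉ A} = Aᶜ.card := by
    rw [Fintype.card_subtype_compl, Fintype.card_coe, Finset.card_compl]
  have hcol : ∀ z : {i // i ∉ A} → Fin 2,
      ∑ y, ‖coeffMatrix (modularState r n).amp A y z‖ =
        s * weightCount {i // i ∈ A} (-weightMod r z) := by
    intro z
    simp_rw [coeffMatrix_apply, norm_modularState, weightMod_glue, ← eq_neg_iff_add_eq_zero]
    rw [← Finset.sum_filter, Finset.sum_const, nsmul_eq_mul, mul_comm]
    rfl
  have hrow : ∑ z, ‖coeffMatrix (modularState r n).amp A x z‖ =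
        s * weightCount {i // i ∉ A} (-weightMod r x) := by
    simp_rw [coeffMatrix_apply, norm_modularState, weightMod_glue, add_comm (weightMod r x),
      ← eq_neg_iff_add_eq_zero]
    rw [← Finset.sum_filter, Finset.sum_const, nsmul_eq_mul, mul_comm]
    rfl
  have hA1 : ∀ c : ZMod r, (weightCount {i // i ∈ A} c : ℝ) ≤ 2 * 2 ^ A.card / r := by
    intro c
    have := (ha₀ {i // i ∈ A} (by rwa [hcA]) c).2
    rw [hcA] at this
    rw [le_div_iff₀ hr]; linarith
  have hA2 : ∀ c : ZMod r, (weightCount {i // i ∉ A} c : ℝ) ≤ 2 * 2 ^ Aᶜ.card / r := by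
    intro c
    have := (ha₀ {i // i ∉ A} (by rwa [hcA']) c).2
    rw [hcA'] at this
    rw [le_div_iff₀ hr]; linarith
  have hn : A.card + Aᶜ.card = n := by rw [Finset.card_add_card_compl, Fintype.card_fin]
  have hWn : 2 ^ n ≤ 2 * ((r : ℝ) * W) := by
    have := (ha₀ (Fin n) (by rw [Fintype.card_fin]; omega) 0).1
    rwa [Fintype.card_fin] at this
  calc ∑ y, ‖reducedDensity (modularState r n).amp A x y‖
      ≤ ∑ y, ∑ z, ‖coeffMatrix (modularState r n).amp A x z‖ *
          ‖coeffMatrix (modularState r n).amp A y z‖ := by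
        refine Finset.sum_le_sum fun y _ => ?_
        rw [reducedDensity, Matrix.mul_apply]
        refine (norm_sum_le _ _).trans_eq (Finset.sum_congr rfl fun z _ => ?_)
        rw [norm_mul, Matrix.conjTranspose_apply, norm_star]
    _ = ∑ z, ‖coeffMatrix (modularState r n).amp A x z‖ *
          (s * weightCount {i // i ∈ A} (-weightMod r z)) := by
        rw [Finset.sum_comm]
        refine Finset.sum_congr rfl fun z _ => ?_
        rw [← Finset.mul_sum, hcol]
    _ ≤ ∑ z, ‖coeffMatrix (modularState r n).amp A x z‖ * (s * (2 * 2 ^ A.card / r)) := by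
        gcongr with z; exact hA1 _
    _ = s * weightCount {i // i ∉ A} (-weightMod r x) * (s * (2 * 2 ^ A.card / r)) := by
        rw [← Finset.sum_mul, hrow]
    _ ≤ s * (2 * 2 ^ Aᶜ.card / r) * (s * (2 * 2 ^ A.card / r)) := by
        gcongr; exact hA2 _
    _ = (s * s) * (4 * 2 ^ n / (r * r)) := by
        rw [show (2 : ℝ) ^ n = 2 ^ A.card * 2 ^ Aᶜ.card by rw [← pow_add, hn]]
        field_simp; norm_num
    _ ≤ 8 / r := by
        rw [hs2, inv_mul_eq_div, div_div, div_le_div_iff₀ (by positivity) hr]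
        nlinarith

/-- There are states of arbitrarily large entropic entanglement width. -/
theorem exists_entropicWidth_gt (C : ℝ) :
    ∃ n, 2 ≤ n ∧ ∃ φ : QubitState n, C < entropicWidth φ := by
  obtain ⟨r, hr⟩ := exists_nat_gt (8 * (2 : ℝ) ^ C)
  have hr0 : (0 : ℝ) < r := lt_trans (by positivity) hr
  have : NeZero r := ⟨by rintro rfl; simp at hr0⟩
  obtain ⟨a₀, ha₀⟩ := weightCount_bounds r
  -- This size admits cuts with `a₀` qubits on both sides in every tree, and is at least two even if
  -- `a₀ = 0`. The choice `r > 8 * 2 ^ C` makes `log₂ (r / 8)` exceed `C`.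
  refine ⟨3 * a₀ + 2, by omega, modularState r _, ?_⟩
  refine lt_of_lt_of_le (b := Real.logb 2 (r / 8)) ?_
    (le_treeMinMax (a := a₀) (by omega) (by omega) fun A hA hA' => ?_)
  · rw [Real.lt_logb_iff_rpow_lt one_lt_two (by positivity)]
    linarith
  · rw [entanglementEntropy_eq_specEntropy, Real.logb]
    refine div_le_div_of_nonneg_right ?_ (Real.log_nonneg one_le_two)
    have := neg_log_le_specEntropy (reducedDensity_posSemidef (modularState r _).amp A)
      (by rw [trace_reducedDensity, (modularState r _).normalized, Complex.ofReal_one])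
      (sum_row_reducedDensity_modularState_le ha₀ hA hA')
    rwa [← Real.log_inv, inv_div] at this

end ModularState

/-! ### Universal resources have unbounded widths. -/

section UniversalResources

theorem IsUniversalResource.exists_entropicWidth_gt {Ψ : Set MultiQubitState}
    (hΨ : IsUniversalResource Ψ) (C : ℝ) : ∃ s ∈ Ψ, C < entropicWidth s.state := by
  obtain ⟨n, hn, φ, hφ⟩ := _root_.exists_entropicWidth_gt C
  obtain ⟨s, hs, h⟩ := hΨ n φ
  exact ⟨s, hs, hφ.trans_le (entropicWidth_le_of_LOCCGe hn h)⟩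

theorem IsUniversalResource.exists_schmidtRankWidth_gt {Ψ : Set MultiQubitState}
    (hΨ : IsUniversalResource Ψ) (C : ℝ) : ∃ s ∈ Ψ, C < schmidtRankWidth s.state := by
  obtain ⟨n, hn, φ, hφ⟩ := _root_.exists_entropicWidth_gt C
  obtain ⟨s, hs, h⟩ := hΨ n φ
  exact ⟨s, hs, (hφ.trans_le (entropicWidth_le_schmidtRankWidth φ)).trans_le
    (schmidtRankWidth_le_of_LOCCGe hn h)⟩

theorem supOver_eq_top {E : ∀ {n : ℕ}, QubitState n → ℝ} {Ψ : Set MultiQubitState}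
    (h : ∀ C : ℝ, ∃ s ∈ Ψ, C < E s.state) : supOver E Ψ = ⊤ := by
  rw [EReal.eq_top_iff_forall_lt]
  intro C
  obtain ⟨s, hs, hC⟩ := h C
  exact lt_of_lt_of_le (EReal.coe_lt_coe_iff.2 hC)
    (le_iSup₂ (f := fun (s : MultiQubitState) (_ : s ∈ Ψ) => ((E s.state : ℝ) : EReal)) s hs)

theorem not_isUniversalResource_of_isBoundedOn {Ψ : Set MultiQubitState}
    (h : IsBoundedOn entropicWidth Ψ ∨ IsBoundedOn schmidtRankWidth Ψ) :
    ¬ IsUniversalResource Ψ := by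
  intro hΨ
  rcases h with ⟨C, hC⟩ | ⟨C, hC⟩
  · obtain ⟨s, hs, h⟩ := hΨ.exists_entropicWidth_gt C
    exact absurd (hC s hs) (not_le.2 h)
  · obtain ⟨s, hs, h⟩ := hΨ.exists_schmidtRankWidth_gt C
    exact absurd (hC s hs) (not_le.2 h)

theorem bounded_of_schmidtRankWidth_le {Ψ : Set MultiQubitState} (C : ℝ)
    (h : ∀ s ∈ Ψ, schmidtRankWidth s.state ≤ C) :
    IsBoundedOn entropicWidth Ψ ∧ IsBoundedOn schmidtRankWidth Ψ ∧ ¬ IsUniversalResource Ψ :=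
  ⟨⟨C, fun s hs => (entropicWidth_le_schmidtRankWidth s.state).trans (h s hs)⟩, ⟨C, h⟩,
    not_isUniversalResource_of_isBoundedOn (Or.inr ⟨C, h⟩)⟩

end UniversalResources

/-! ### Schmidt ranks of graph states, linear clusters and GHZ states. -/

section GraphStates

open Matrix

theorem tensorOp_mulVec_apply {ι L : Type} [Fintype ι] [DecidableEq ι] [Fintype L] [DecidableEq L]
    (P : ι → Matrix L L ℂ) (v : (ι → L) → ℂ) (x : ι → L) :
    (tensorOp P *ᵥ v) x = ∑ y, (∏ i, P i (x i) (y i)) * v y := rfl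

open Classical in
/-- The phase relating the amplitudes of a graph state at `x` and at `x` flipped at `a`. -/
noncomputable def flipPhase {n : ℕ} (G : SimpleGraph (Fin n)) (a : Fin n) (x : Fin n → Fin 2) : ℂ :=
  ∏ b, if G.Adj a b then (-1) ^ (x b : ℕ) else 1

theorem flipPhase_mul_self {n : ℕ} (G : SimpleGraph (Fin n)) (a : Fin n) (x : Fin n → Fin 2) :
    flipPhase G a x * flipPhase G a x = 1 := by
  rw [flipPhase, ← Finset.prod_mul_distrib]
  refine Finset.prod_eq_one fun b _ => ?_
  split_ifs
  · rw [← mul_pow]; simp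
  · simp

/-- In row `x` of the correlation operator at `a`, only the column with bit `a` flipped survives;
the neighbours of `a` supply the sign. -/
theorem IsGraphState.amp_eq {n : ℕ} {G : SimpleGraph (Fin n)} {ψ : QubitState n}
    (hψ : IsGraphState G ψ) (a : Fin n) (x : Fin n → Fin 2) :
    ψ.amp x = flipPhase G a x * ψ.amp (Function.update x a (x a + 1)) := by
  classical
  conv_lhs => rw [← hψ a]
  have hX : ∀ t : Fin 2, pauliX t t = 0 ∧ pauliX t (t + 1) = 1 := by
    intro t; fin_cases t <;> simp [pauliX]
  have hZ : ∀ t : Fin 2, pauliZ t t = (-1) ^ (t : ℕ) := by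
    intro t; fin_cases t <;> simp [pauliZ]
  have hZ' : ∀ s t : Fin 2, s ≠ t → pauliZ s t = 0 := by
    intro s t h; fin_cases s <;> fin_cases t <;> simp [pauliZ] at h ⊢
  have h2 : ∀ s t : Fin 2, t ≠ s + 1 → s = t := by decide
  rw [correlationOp, tensorOp_mulVec_apply,
    Fintype.sum_eq_single (Function.update x a (x a + 1))]
  · congr 1
    refine Finset.prod_congr rfl fun b _ => ?_
    by_cases hb : b = a
    · subst hb
      simp [(hX _).2]
    · rw [if_neg hb, Function.update_of_ne hb]
      split_ifs
      · exact hZ _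
      · exact one_apply_eq _
  · intro y hy
    obtain ⟨i, hi⟩ := Function.ne_iff.1 hy
    rw [Finset.prod_eq_zero (Finset.mem_univ i), zero_mul]
    by_cases hia : i = a
    · subst hia
      rw [Function.update_self] at hi
      rw [if_pos rfl, ← h2 _ _ hi, (hX _).1]
    · rw [Function.update_of_ne hia] at hi
      rw [if_neg hia]
      split_ifs
      · exact hZ' _ _ hi.symm
      · exact one_apply_ne hi.symm

/-- The sign `(-1) ^ w`. -/
def zmodSign (w : ZMod 2) : ℂ := (-1) ^ w.val

theorem zmodSign_add (w w' : ZMod 2) : zmodSign (w + w') = zmodSign w * zmodSign w' := by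
  have h : ∀ w w' : ZMod 2, (w + w').val = (w.val + w'.val) % 2 := by decide
  rw [zmodSign, zmodSign, zmodSign, h, ← neg_one_pow_eq_pow_mod_two, pow_add]

open Classical in
/-- The block of the adjacency matrix that defines the cut rank. -/
noncomputable def cutMatrix {n : ℕ} (G : SimpleGraph (Fin n)) (A : Finset (Fin n)) :
    Matrix {i // i ∈ A} {j // j ∉ A} (ZMod 2) :=
  Matrix.of fun i j => if G.Adj i j then 1 else 0

theorem cutRank_eq {n : ℕ} (G : SimpleGraph (Fin n)) (A : Finset (Fin n)) :
    cutRank G A = (cutMatrix G A).rank := rfl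

/-- Neighbours inside `A` give a sign that depends on `x` alone; those outside give the character of
`z` defined by row `a` of the cut matrix. -/
theorem flipPhase_glue {n : ℕ} (G : SimpleGraph (Fin n)) (A : Finset (Fin n)) (a : {i // i ∈ A})
    (x : {i // i ∈ A} → Fin 2) : ∃ c : ℂ, ∀ z : {i // i ∉ A} → Fin 2,
      flipPhase G a (glue A x z) = c * ∏ b, zmodSign (cutMatrix G A a b) ^ (z b : ℕ) := by
  classical
  refine ⟨∏ b : {i // i ∈ A}, if G.Adj a b then (-1) ^ (x b : ℕ) else 1, fun z => ?_⟩
  rw [flipPhase, ← Fintype.prod_subtype_mul_prod_subtype (fun i => i ∈ A)]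
  congr 1
  · refine Finset.prod_congr (by ext; simp) fun b _ => ?_
    rw [glue_of_mem A _ _ b.2]
  · refine Finset.prod_congr (by ext; simp) fun b _ => ?_
    rw [glue_of_notMem A _ _ b.2, cutMatrix, of_apply]
    split_ifs
    · simp [zmodSign, ZMod.val_one]
    · simp [zmodSign]

/-- Starting from the zero configuration, the bits in `S` are flipped one by one. Each flip
contributes a scalar and the character of one row of the cut matrix, and characters multiply as rows
add modulo two. -/
theorem IsGraphState.coeffMatrix_indicator {n : ℕ} {G : SimpleGraph (Fin n)} {ψ : QubitState n}
    (hψ : IsGraphState G ψ) (A : Finset (Fin n)) (S : Finset {i // i ∈ A}) :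
    ∃ c : ℂ, ∀ z, coeffMatrix ψ.amp A (fun i => if i ∈ S then 1 else 0) z =
      c * (∏ b, zmodSign (∑ a ∈ S, cutMatrix G A a b) ^ (z b : ℕ)) *
        coeffMatrix ψ.amp A 0 z := by
  induction S using Finset.induction_on with
  | empty =>
    refine ⟨1, fun z => ?_⟩
    simp [zmodSign, Pi.zero_def]
  | insert a S ha ih =>
    obtain ⟨c, hc⟩ := ih
    obtain ⟨c', hc'⟩ := flipPhase_glue G A a (fun i => if i ∈ S then 1 else 0)
    refine ⟨c' * c, fun z => ?_⟩
    have h1 := hψ.amp_eq a (glue A (fun i => if i ∈ S then 1 else 0) z)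
    rw [← glue_update_mem, glue_of_mem A _ _ a.2] at h1
    have h2 : (Function.update (fun i : {i // i ∈ A} => if i ∈ S then (1 : Fin 2) else 0) a
        ((if a ∈ S then 1 else 0) + 1)) = fun i => if i ∈ insert a S then 1 else 0 := by
      ext1 i
      by_cases hi : i = a
      · subst hi; simp [ha]
      · simp [hi]
    simp only [Subtype.coe_eta] at h1
    rw [h2] at h1
    have h3 : coeffMatrix ψ.amp A (fun i => if i ∈ insert a S then 1 else 0) z =
        flipPhase G a (glue A (fun i => if i ∈ S then 1 else 0) z) *
          coeffMatrix ψ.amp A (fun i => if i ∈ S then 1 else 0) z := by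
      rw [coeffMatrix_apply, coeffMatrix_apply, h1, ← mul_assoc, flipPhase_mul_self, one_mul]
    rw [h3, hc, hc']
    simp_rw [Finset.sum_insert ha, zmodSign_add, mul_pow, Finset.prod_mul_distrib]
    ring

/-- The Schmidt rank of a graph state is bounded by the cut rank of the graph. -/
theorem IsGraphState.schmidtRank_le {n : ℕ} {G : SimpleGraph (Fin n)} {ψ : QubitState n}
    (hψ : IsGraphState G ψ) (A : Finset (Fin n)) : schmidtRank ψ.amp A ≤ 2 ^ cutRank G A := by
  classical
  rw [schmidtRank_eq, cutRank_eq]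
  set Γ := cutMatrix G A with hΓ
  -- The row space of `Γ`, with `2 ^ rank` elements. Up to a scalar, row `x` of the coefficient
  -- matrix depends only on the sum `w x` of the rows of `Γ` selected by `x`, so the matrix factors
  -- through the index set `R`.
  let R := LinearMap.range Γᵀ.mulVecLin
  have : Fintype R := Fintype.ofFinite R
  have hR : Fintype.card R = 2 ^ Γ.rank := by
    rw [Module.card_eq_pow_finrank (K := ZMod 2), ZMod.card, ← rank_transpose Γ]
    rfl
  let w : ({i // i ∈ A} → Fin 2) → R := fun x =>
    ⟨Γᵀ.mulVecLin fun i => if x i = 1 then 1 else 0, LinearMap.mem_range_self _ _⟩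
  have hc : ∀ x, ∃ c : ℂ, ∀ z, coeffMatrix ψ.amp A x z =
      c * (∏ b, zmodSign ((w x : {i // i ∉ A} → ZMod 2) b) ^ (z b : ℕ)) *
        coeffMatrix ψ.amp A 0 z := by
    intro x
    obtain ⟨c, hc⟩ := hψ.coeffMatrix_indicator A (Finset.univ.filter fun i => x i = 1)
    refine ⟨c, fun z => ?_⟩
    have hx : (fun i => if i ∈ Finset.univ.filter (fun i => x i = 1) then (1 : Fin 2) else 0) =
        x := by
      ext1 i
      have : ∀ t : Fin 2, (if t = 1 then (1 : Fin 2) else 0) = t := by decide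
      simpa using this (x i)
    rw [hx] at hc
    rw [hc]
    congr 2
    refine Finset.prod_congr rfl fun b _ => ?_
    congr 2
    change _ = (Γᵀ *ᵥ fun i => if x i = 1 then 1 else 0) b
    rw [mulVec, dotProduct, Finset.sum_filter]
    exact Finset.sum_congr rfl fun a _ => by simp [hΓ]
  choose c hc using hc
  let M₁ : Matrix ({i // i ∈ A} → Fin 2) R ℂ := of fun x v => if v = w x then c x else 0
  let M₂ : Matrix R ({i // i ∉ A} → Fin 2) ℂ := of fun v z =>
    (∏ b, zmodSign ((v : {i // i ∉ A} → ZMod 2) b) ^ (z b : ℕ)) * coeffMatrix ψ.amp A 0 z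
  have hM : coeffMatrix ψ.amp A = M₁ * M₂ := by
    ext x z
    rw [hc x z]
    simp [M₁, M₂, mul_apply, mul_assoc]
  rw [hM, ← hR]
  exact (rank_mul_le_left _ _).trans (rank_le_card_width _)

theorem schmidtRankWidth_le_of_tree {n : ℕ} {ψ : QubitState n} (T : SubcubicTree (Fin n)) {k : ℕ}
    (h : ∀ d, schmidtRank ψ.amp (T.side d) ≤ 2 ^ k) : schmidtRankWidth ψ ≤ k := by
  refine (treeMinMax_le (Set.finite_range _).bddBelow T).trans ?_
  have := T.nonempty_dart
  refine ciSup_le fun d => ?_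
  rw [Real.logb_le_iff_le_rpow one_lt_two (by exact_mod_cast schmidtRank_pos _ _),
    Real.rpow_natCast]
  exact_mod_cast h d

theorem schmidtRankWidth_of_isEmpty {n : ℕ} (ψ : QubitState n)
    (h : IsEmpty (SubcubicTree (Fin n))) : schmidtRankWidth ψ = 0 := by
  rw [schmidtRankWidth, treeMinMax, Real.iInf_of_isEmpty]

theorem IsGraphState.schmidtRankWidth_le {n : ℕ} {G : SimpleGraph (Fin n)} {ψ : QubitState n}
    (hψ : IsGraphState G ψ) : schmidtRankWidth ψ ≤ rankWidth G := by
  rcases isEmpty_or_nonempty (SubcubicTree (Fin n)) with h | h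
  · rw [schmidtRankWidth_of_isEmpty ψ h]; positivity
  · obtain ⟨T, hT⟩ : rankWidth G ∈
        Set.range fun T : SubcubicTree (Fin n) => ⨆ d, cutRank G (T.side d) :=
      Nat.sInf_mem (Set.range_nonempty _)
    refine schmidtRankWidth_le_of_tree T fun d => (hψ.schmidtRank_le _).trans ?_
    rw [← hT]
    exact Nat.pow_le_pow_right two_pos (T.le_iSup_side (cutRank G) d)

theorem cutMatrix_compl_rank_le_of_card {n : ℕ} (G : SimpleGraph (Fin n)) {A : Finset (Fin n)}
    (hA : A.card ≤ 1) : cutRank G A ≤ 1 ∧ cutRank G Aᶜ ≤ 1 := by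
  rw [cutRank_eq, cutRank_eq]
  constructor
  · exact (rank_le_card_height _).trans (by rwa [Fintype.card_coe])
  · refine (rank_le_card_width _).trans ?_
    rwa [Fintype.card_subtype_compl, Fintype.card_coe, Finset.card_compl, Nat.sub_sub_self]
    exact Finset.card_le_univ A

/-- At most the edge from `k - 1` to `k` crosses the cut, so the block is an outer product of two
indicator vectors. The complement is included because a decomposition controls sides only up to
complement. -/
theorem cutRank_pathGraph_initial {n : ℕ} (k : ℕ) :
    cutRank (SimpleGraph.pathGraph n) (Finset.univ.filter fun i => (i : ℕ) < k) ≤ 1 ∧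
      cutRank (SimpleGraph.pathGraph n) (Finset.univ.filter fun i => (i : ℕ) < k)ᶜ ≤ 1 := by
  classical
  rw [cutRank_eq, cutRank_eq]
  set A : Finset (Fin n) := Finset.univ.filter fun i => (i : ℕ) < k with hA
  constructor
  · refine le_trans (le_of_eq (congrArg _ ?_)) (rank_vecMulVec_le
      (fun i : {i // i ∈ A} => if ((i : Fin n) : ℕ) + 1 = k then (1 : ZMod 2) else 0)
      (fun j : {j // j ∉ A} => if ((j : Fin n) : ℕ) = k then (1 : ZMod 2) else 0))
    ext ⟨i, hi⟩ ⟨j, hj⟩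
    simp only [hA, Finset.mem_filter, Finset.mem_univ, true_and] at hi hj
    simp only [cutMatrix, of_apply, SimpleGraph.pathGraph_adj, vecMulVec_apply]
    split_ifs <;> first | rfl | (exfalso; omega)
  · refine le_trans (le_of_eq (congrArg _ ?_)) (rank_vecMulVec_le
      (fun j : {j // j ∈ Aᶜ} => if ((j : Fin n) : ℕ) = k then (1 : ZMod 2) else 0)
      (fun i : {i // i ∉ Aᶜ} => if ((i : Fin n) : ℕ) + 1 = k then (1 : ZMod 2) else 0))
    ext ⟨i, hi⟩ ⟨j, hj⟩
    simp only [hA, Finset.mem_filter, Finset.mem_univ, true_and, Finset.mem_compl, not_not] at hi hj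
    simp only [cutMatrix, of_apply, SimpleGraph.pathGraph_adj, vecMulVec_apply]
    split_ifs <;> first | rfl | (exfalso; omega)

theorem branchDecomp_pathGraph {n : ℕ} (k : ℕ) (hk : k + 1 ≤ n) :
    BranchDecomp (fun A => cutRank (SimpleGraph.pathGraph n) A ≤ 1 ∧
      cutRank (SimpleGraph.pathGraph n) Aᶜ ≤ 1) (Finset.univ.filter fun i => (i : ℕ) < k + 1) := by
  induction k with
  | zero =>
    have : (Finset.univ.filter fun i : Fin n => (i : ℕ) < 0 + 1) = {⟨0, hk⟩} := by
      ext i; simp [Fin.ext_iff]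
    rw [this]
    exact .leaf _ (cutMatrix_compl_rank_le_of_card _ (by simp))
  | succ k ih =>
    have : (Finset.univ.filter fun i : Fin n => (i : ℕ) < k + 1 + 1) =
        (Finset.univ.filter fun i : Fin n => (i : ℕ) < k + 1) ∪ {⟨k + 1, hk⟩} := by
      ext i; simp [Fin.ext_iff]; omega
    have h := cutRank_pathGraph_initial (n := n) (k + 1 + 1)
    rw [this] at h ⊢
    exact .node (by simp) (ih (by omega))
      (.leaf _ (cutMatrix_compl_rank_le_of_card _ (by simp))) h

theorem rankWidth_pathGraph_le (n : ℕ) : rankWidth (SimpleGraph.pathGraph n) ≤ 1 := by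
  have key : ∀ T : SubcubicTree (Fin n),
      (∀ d, cutRank (SimpleGraph.pathGraph n) (T.side d) ≤ 1) →
        rankWidth (SimpleGraph.pathGraph n) ≤ 1 := by
    intro T hT
    have := T.nonempty_dart
    exact (treeMinMax_le (Set.finite_range _).bddBelow T).trans (ciSup_le hT)
  by_cases hn : 2 ≤ n
  · have h := branchDecomp_pathGraph (n := n) (n - 2) (by omega)
    -- The initial segment omits only the last vertex of the path, which becomes the planted leaf.
    have he : (Finset.univ.filter fun i : Fin n => (i : ℕ) < n - 2 + 1) =
        Finset.univ.erase ⟨n - 1, by omega⟩ := by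
      ext i; simp [Fin.ext_iff]; omega
    rw [he] at h
    obtain ⟨T, hT⟩ := h.exists_subcubicTree
    refine key T fun d => ?_
    rcases hT d with h | h
    · exact h.1
    · simpa using h.2
  · rcases isEmpty_or_nonempty (SubcubicTree (Fin n)) with h | ⟨⟨T⟩⟩
    · rw [rankWidth, treeMinMax, Nat.iInf_of_empty]; exact zero_le_one
    · refine key T fun d => (cutMatrix_compl_rank_le_of_card _ ?_).1
      refine (Finset.card_le_univ _).trans ?_
      rw [Fintype.card_fin]; omega

/-- The coefficient matrix factors through the common value of all bits, an index set with two
elements. -/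
theorem IsGHZ.schmidtRank_le {n : ℕ} {ψ : QubitState n} (hψ : IsGHZ ψ) (A : Finset (Fin n)) :
    schmidtRank ψ.amp A ≤ 2 := by
  classical
  rw [schmidtRank_eq]
  obtain ⟨s, hs⟩ : ∃ s : ℂ, s = (((Real.sqrt 2)⁻¹ : ℝ) : ℂ) := ⟨_, rfl⟩
  let M₁ : Matrix ({i // i ∈ A} → Fin 2) (Fin 2) ℂ := of fun x t => if x = fun _ => t then s else 0
  let M₂ : Matrix (Fin 2) ({i // i ∉ A} → Fin 2) ℂ := of fun t z => if z = fun _ => t then 1 else 0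
  have hglue : ∀ (x : {i // i ∈ A} → Fin 2) (z : {i // i ∉ A} → Fin 2) (t : Fin 2),
      (glue A x z = fun _ => t) ↔ (x = fun _ => t) ∧ z = fun _ => t := by
    intro x z t
    constructor
    · intro h
      constructor
      · ext1 i
        rw [← congrFun h i, glue_of_mem A _ _ i.2]
      · ext1 i
        rw [← congrFun h i, glue_of_notMem A _ _ i.2]
    · rintro ⟨rfl, rfl⟩
      ext1 i
      by_cases hi : i ∈ A
      · rw [glue_of_mem A _ _ hi]
      · rw [glue_of_notMem A _ _ hi]
  have hM : coeffMatrix ψ.amp A = M₁ * M₂ := by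
    ext x z
    rw [coeffMatrix_apply, hψ.2, ← hs, mul_apply, Fin.sum_univ_two]
    simp only [Pi.smul_apply, Pi.add_apply, Pi.single_apply, hglue, smul_eq_mul, M₁, M₂, of_apply,
      ite_and]
    split_ifs <;> simp [mul_add]
  rw [hM]
  exact (rank_mul_le_left _ _).trans ((rank_le_card_width _).trans (by simp))

theorem IsGHZ.schmidtRankWidth_le {n : ℕ} {ψ : QubitState n} (hψ : IsGHZ ψ) :
    schmidtRankWidth ψ ≤ 1 := by
  rcases isEmpty_or_nonempty (SubcubicTree (Fin n)) with h | ⟨⟨T⟩⟩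
  · rw [schmidtRankWidth_of_isEmpty ψ h]; exact zero_le_one
  · exact_mod_cast schmidtRankWidth_le_of_tree T (k := 1) fun d => by simpa using hψ.schmidtRank_le _

end GraphStates

theorem mainTheorem2 :
    (∀ Ψ : Set MultiQubitState, IsUniversalResource Ψ →
      supOver entropicWidth Ψ = ⊤ ∧ supOver schmidtRankWidth Ψ = ⊤) ∧
    (∀ Ψ : Set MultiQubitState,
      IsBoundedOn entropicWidth Ψ ∨ IsBoundedOn schmidtRankWidth Ψ → ¬ IsUniversalResource Ψ) ∧
    (∀ Ψ : Set MultiQubitState, (∀ s ∈ Ψ, IsLinearCluster s.state) →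
      IsBoundedOn entropicWidth Ψ ∧ IsBoundedOn schmidtRankWidth Ψ ∧ ¬ IsUniversalResource Ψ) ∧
    (∀ Ψ : Set MultiQubitState, (∀ s ∈ Ψ, IsGHZ s.state) →
      IsBoundedOn entropicWidth Ψ ∧ IsBoundedOn schmidtRankWidth Ψ ∧ ¬ IsUniversalResource Ψ) ∧
    (∀ (Ψ : Set MultiQubitState) (k : ℕ),
      (∀ s ∈ Ψ, ∃ G : SimpleGraph (Fin s.numQubits), IsGraphState G s.state ∧ rankWidth G ≤ k) →
      IsBoundedOn entropicWidth Ψ ∧ IsBoundedOn schmidtRankWidth Ψ ∧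
        ¬ IsUniversalResource Ψ) := by
  refine ⟨fun Ψ hΨ => ⟨supOver_eq_top hΨ.exists_entropicWidth_gt,
    supOver_eq_top hΨ.exists_schmidtRankWidth_gt⟩,
    fun Ψ => not_isUniversalResource_of_isBoundedOn, fun Ψ hΨ => ?_, fun Ψ hΨ => ?_,
    fun Ψ k hΨ => ?_⟩
  · refine bounded_of_schmidtRankWidth_le 1 fun s hs => ?_
    have h := (hΨ s hs).schmidtRankWidth_le
    exact h.trans (by exact_mod_cast rankWidth_pathGraph_le _)
  · exact bounded_of_schmidtRankWidth_le 1 fun s hs => (hΨ s hs).schmidtRankWidth_le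
  · refine bounded_of_schmidtRankWidth_le k fun s hs => ?_
    obtain ⟨G, hG, hk⟩ := hΨ s hs
    exact hG.schmidtRankWidth_le.trans (by exact_mod_cast hk)
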